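/- **Feynman triple limit.** For $\varepsilon>0$, a \emph{checker path} on the lattice $\varepsilon\mathbb{Z}^2=\{(x,t): x/\varepsilon,\,t/\varepsilon\in\mathbb{Z}\}$ is a finite sequence of lattice points such that the vector from each point (except the last one) to the next one equals either $(\varepsilon,\varepsilon)$ or $(-\varepsilon,\varepsilon)$. For a checker path $s$ let $\mathrm{turns}(s)$ be the number of points of $s$, neither the first nor the last one, such that the vectors from the point to the next and to the previous ones are orthogonal. For $m\ge 0$, $\varepsilon>0$ and $(x,t)\in\varepsilon\mathbb{Z}^2$ with $t>0$, put $$a(x,t,m,\varepsilon):=(1+m^2\varepsilon^2)^{(1-t/\varepsilon)/2}\; i\,\sum_s(-im\varepsilon)^{\mathrm{turns}(s)},$$ where the sum is over all checker paths $s$ on $\varepsilon\mathbb{Z}^2$ from $(0,0)$ to $(x,t)$ with the first step to $(\varepsilon,\varepsilon)$, and $0^0:=1$. Let $m\ge 0$, and let $(x_n,t_n,\varepsilon_n)$ be a sequence of triples of real numbers with $\varepsilon_n>0$ and $t_n>0$ such that $(x_n,t_n)\in\varepsilon_n\mathbb{Z}^2$, $(x_n+t_n)/\varepsilon_n$ is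 even, and $$\frac1{t_n}\to0,\qquad \frac{x_n}{t_n^{3/4}}\to0,\qquad \varepsilon_n t_n^{1/2}\to 0\qquad\text{as }n\to\infty.$$ Then $$\frac{1}{2i\varepsilon_n}\,a(x_n,t_n,m,\varepsilon_n)\ \sim\ \sqrt{\frac{m}{2\pi t_n}}\,\exp\left(-imt_n-\frac{i\pi}{4}+\frac{imx_n^2}{2t_n}\right)\qquad\text{as }n\to\infty,$$ where $u_n\sim v_n$ means $u_n-v_n=o(v_n)$. -/

import Mathlib

open Filter Topology Asymptotics

namespace FeynmanCheckers

/-- The lattice `εℤ² = {(x, t) : x/ε ∈ ℤ and t/ε ∈ ℤ}` (for `ε > 0`). -/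
def lattice (ε : ℝ) : Set (ℝ × ℝ) :=
  {p | (∃ k : ℤ, p.1 / ε = k) ∧ (∃ l : ℤ, p.2 / ε = l)}

/-- The vector from `p` to `q` equals `(ε, ε)` or `(-ε, ε)`. -/
def IsStep (ε : ℝ) (p q : ℝ × ℝ) : Prop :=
  q - p = (ε, ε) ∨ q - p = (-ε, ε)

/-- A checker path: a finite sequence of lattice points in which the vector from each point
(except the last one) to the next one equals `(ε, ε)` or `(-ε, ε)`. -/
def IsCheckerPath (ε : ℝ) (s : List (ℝ × ℝ)) : Prop :=
  (∀ p ∈ s, p ∈ lattice ε) ∧ s.IsChain (IsStep ε)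

/-- Orthogonality of two vectors of the Euclidean plane. -/
def Orthogonal (v w : ℝ × ℝ) : Prop :=
  v.1 * w.1 + v.2 * w.2 = 0

open Classical in
/-- The number of points of `s`, neither the first nor the last one, such that the vectors from
the point to the next and to the previous point are orthogonal. -/
noncomputable def turns : List (ℝ × ℝ) → ℕ
  | p :: q :: r :: s => (if Orthogonal (r - q) (p - q) then 1 else 0) + turns (q :: r :: s)
  | _ => 0

/-- The checker paths from `(0, 0)` to `(x, t)` with the first step to `(ε, ε)`. -/
def pathsTo (x t ε : ℝ) : Set (List (ℝ × ℝ)) :=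
  {s | IsCheckerPath ε s ∧ s.head? = some (0, 0) ∧ s[1]? = some (ε, ε) ∧
    s.getLast? = some (x, t)}

/-- The lattice kernel
`a(x, t, m, ε) = (1 + m²ε²)^((1 - t/ε)/2) · i · ∑ₛ (-imε)^turns(s)`,
where the sum is over all checker paths from `(0, 0)` to `(x, t)` with the first step to `(ε, ε)`.
The sum is finite for `ε > 0` by `pathsTo_finite`. -/
noncomputable def a (x t m ε : ℝ) : ℂ :=
  (((1 + m ^ 2 * ε ^ 2) ^ ((1 - t / ε) / 2) : ℝ) : ℂ) * Complex.I *
    ∑ᶠ s ∈ pathsTo x t ε, (-Complex.I * (m : ℂ) * (ε : ℂ)) ^ turns s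

theorem chains_finite (ε : ℝ) (k : ℕ) (p : ℝ × ℝ) :
    {s : List (ℝ × ℝ) | (p :: s).IsChain (IsStep ε) ∧ s.length = k}.Finite := by
  induction k generalizing p with
  | zero =>
    refine (Set.finite_singleton ([] : List (ℝ × ℝ))).subset ?_
    rintro s ⟨_, hs⟩
    simpa using hs
  | succ k ih =>
    refine (((ih (p + (ε, ε))).image (List.cons (p + (ε, ε)))).union
      ((ih (p + (-ε, ε))).image (List.cons (p + (-ε, ε))))).subset ?_
    rintro s ⟨hc, hl⟩
    match s, hl with
    | q :: s, hl =>
      rw [List.isChain_cons_cons] at hc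
      obtain ⟨h, hc⟩ := hc
      rcases h with h | h
      · left
        have hq : q = p + (ε, ε) := by rw [← h]; abel
        subst hq
        exact ⟨s, ⟨hc, by simpa using hl⟩, rfl⟩
      · right
        have hq : q = p + (-ε, ε) := by rw [← h]; abel
        subst hq
        exact ⟨s, ⟨hc, by simpa using hl⟩, rfl⟩

theorem chain_getLast_snd (ε : ℝ) (s : List (ℝ × ℝ)) (p y : ℝ × ℝ)
    (hc : (p :: s).IsChain (IsStep ε)) (hy : (p :: s).getLast? = some y) :
    y.2 = p.2 + s.length * ε := by
  induction s generalizing p with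
  | nil =>
    simp only [List.getLast?_singleton, Option.some.injEq] at hy
    simp [hy]
  | cons q s ih =>
    rw [List.isChain_cons_cons] at hc
    have h := ih q hc.2 (by simpa using hy)
    have hq : q.2 - p.2 = ε := by
      rcases hc.1 with h' | h' <;> simpa using congrArg Prod.snd h'
    rw [h, List.length_cons]
    push_cast
    linarith

/-- The sum in the definition of the kernel is finite. -/
theorem pathsTo_finite (x t ε : ℝ) (hε : 0 < ε) : (pathsTo x t ε).Finite := by
  refine ((chains_finite ε ⌊t / ε⌋₊ (0, 0)).image (List.cons (0, 0))).subset ?_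
  rintro s ⟨⟨_, hc⟩, h0, _, hl⟩
  match s, h0 with
  | p :: s, h0 =>
    have hp : p = (0, 0) := by simpa using h0
    subst hp
    refine ⟨s, ⟨hc, ?_⟩, rfl⟩
    have h := chain_getLast_snd ε s _ _ hc hl
    have h2 : t / ε = s.length := by
      rw [div_eq_iff hε.ne']
      simpa using h
    rw [h2, Nat.floor_natCast]

end FeynmanCheckers

/-! A Fourier transform in space turns the path sum into powers of a 2×2 transfer matrix, with `n =
t/ε - 1` steps left after the prescribed one. Put `μ = mε`. Divided by `√(1 + μ²)`, the matrix has
determinant 1 and trace `2 cos ω`, where `cos ω = cos θ / √(1 + μ²)`. Its powers are therefore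
explicit (`stepFourier_closed`), and the kernel is a sum of two oscillatory integrals, one for each
sign `s` of the frequency (`kernel_eq_waveIntegral`).

Put `θ = εp` and `y = -sx`. For small `ε` and fixed `m > 0`, `ω/ε = m + p²/(2m) + O(p⁴ + ε²)`
(`abs_freq_sub_le`), so up to the sign `s` the phase is close to `mt + tp²/(2m) + yp`, stationary at
`p = -my/t`. With `p = -my/t + u/√t` it becomes `mt - mx²/(2t) + u²/(2m)`. The errors `tp⁴` and
`tε²` vanish in the limit: this is where `x/t^(3/4) → 0`, `1/t → 0` and `ε√t → 0` enter
(`tendsto_phase`). At the stationary point the amplitude tends to `1 - s`. Hence the positive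
frequency contributes only lower order, while the negative one yields twice a Fresnel integral,
whose value supplies the square root and `exp(-iπ/4)`.

On a window `|u| ≤ K` this is dominated convergence (`tendsto_window`). Outside it, van der Corput's
first derivative test (`norm_integral_mul_exp_le`) gives a normalized error `O(1/K)`, uniformly in
all late terms of the sequence; then `K` is taken large (`tendsto_waveIntegral`). Uniformity is the
delicate point: the amplitude changes on the shrinking scale `θ ~ μ`, but its total variation is
bounded independently of `μ`. For `m = 0` both sides are eventually zero. -/

namespace FeynmanCheckers

/-! ### Fourier representation of the path sum -/

/-- The Fourier transforms of the sums of `w ^ turns` over the continuations by `n` steps of a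
path whose last step goes to the right, respectively to the left. -/
noncomputable def stepFourier (w : ℂ) (θ : ℝ) : ℕ → ℂ × ℂ
  | 0 => (1, 1)
  | n + 1 =>
    (Complex.exp (θ * Complex.I) * (stepFourier w θ n).1 +
        w * Complex.exp (-(θ * Complex.I)) * (stepFourier w θ n).2,
      w * Complex.exp (θ * Complex.I) * (stepFourier w θ n).1 +
        Complex.exp (-(θ * Complex.I)) * (stepFourier w θ n).2)

theorem continuous_stepFourier (w : ℂ) (n : ℕ) : Continuous fun θ : ℝ => stepFourier w θ n := by
  induction n with
  | zero => exact continuous_const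
  | succ n ih =>
    simp only [stepFourier]
    fun_prop

/-- The continuations by `n` steps of a path that has arrived at `p`, leading to `y`. -/
def continuations (ε : ℝ) (p : ℝ × ℝ) (n : ℕ) (y : ℝ × ℝ) : Set (List (ℝ × ℝ)) :=
  {l | (p :: l).IsChain (IsStep ε) ∧ l.length = n ∧ (p :: l).getLast? = some y}

theorem continuations_finite (ε : ℝ) (p : ℝ × ℝ) (n : ℕ) (y : ℝ × ℝ) :
    (continuations ε p n y).Finite :=
  (chains_finite ε n p).subset fun _ h => ⟨h.1, h.2.1⟩

theorem isStep_iff (ε : ℝ) (p q : ℝ × ℝ) :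
    IsStep ε p q ↔ q = p + (ε, ε) ∨ q = p + (-ε, ε) := by
  simp only [IsStep, sub_eq_iff_eq_add']

theorem continuations_succ (ε : ℝ) (p : ℝ × ℝ) (n : ℕ) (y : ℝ × ℝ) :
    continuations ε p (n + 1) y =
      List.cons (p + (ε, ε)) '' continuations ε (p + (ε, ε)) n y ∪
        List.cons (p + (-ε, ε)) '' continuations ε (p + (-ε, ε)) n y := by
  ext l
  cases l with
  | nil => simp [continuations]
  | cons q l =>
    simp only [continuations, Set.mem_ofPred_eq, List.isChain_cons_cons, isStep_iff,
      List.length_cons, Nat.add_right_cancel_iff, Set.mem_union, Set.mem_image, List.cons.injEq,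
      List.getLast?_cons_cons]
    constructor
    · rintro ⟨⟨rfl | rfl, h1⟩, h2, h3⟩
      · exact Or.inl ⟨l, ⟨h1, h2, h3⟩, rfl, rfl⟩
      · exact Or.inr ⟨l, ⟨h1, h2, h3⟩, rfl, rfl⟩
    · rintro (⟨l', ⟨h1, h2, h3⟩, rfl, rfl⟩ | ⟨l', ⟨h1, h2, h3⟩, rfl, rfl⟩)
      · exact ⟨⟨Or.inl rfl, h1⟩, h2, h3⟩
      · exact ⟨⟨Or.inr rfl, h1⟩, h2, h3⟩

theorem finsum_continuations_succ {ε : ℝ} (hε : 0 < ε) (p : ℝ × ℝ) (n : ℕ) (y : ℝ × ℝ)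
    (f : List (ℝ × ℝ) → ℂ) :
    ∑ᶠ l ∈ continuations ε p (n + 1) y, f l =
      ∑ᶠ l ∈ continuations ε (p + (ε, ε)) n y, f ((p + (ε, ε)) :: l) +
        ∑ᶠ l ∈ continuations ε (p + (-ε, ε)) n y, f ((p + (-ε, ε)) :: l) := by
  rw [continuations_succ, finsum_mem_union, finsum_mem_image, finsum_mem_image]
  · exact fun _ _ _ _ h => List.cons_injective h
  · exact fun _ _ _ _ h => List.cons_injective h
  · rw [Set.disjoint_left]
    rintro _ ⟨l, _, rfl⟩ ⟨l', _, h⟩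
    have h1 := congrArg Prod.fst (List.cons.inj h).1
    simp only [Prod.fst_add, add_right_inj] at h1
    linarith
  · exact (continuations_finite _ _ _ _).image _
  · exact (continuations_finite _ _ _ _).image _

/-- Even harmonics have period `π`, so they are already orthogonal on half of the usual interval.
There `cos θ ≥ 0`, which later makes the phase convex. -/
theorem integral_exp_even (K : ℤ) (hK : Even K) :
    ∫ θ in (-(Real.pi / 2))..(Real.pi / 2), Complex.exp (-(K * (θ * Complex.I))) =
      if K = 0 then (Real.pi : ℂ) else 0 := by
  split_ifs with h
  · subst h
    simp
  · have hc : (-(K * Complex.I) : ℂ) ≠ 0 := by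
      simp [h]
    have h1 := integral_exp_mul_complex (a := -(Real.pi / 2)) (b := Real.pi / 2) hc
    have h2 : ∀ θ : ℝ, Complex.exp (-(K * (θ * Complex.I))) =
        Complex.exp (-(K * Complex.I) * θ) := fun θ => by ring_nf
    simp_rw [h2]
    rw [h1]
    obtain ⟨j, rfl⟩ := hK
    rw [div_eq_zero_iff]
    left
    rw [sub_eq_zero, Complex.exp_eq_exp_iff_exists_int]
    refine ⟨-j, ?_⟩
    push_cast
    ring

/-- The point put before `p` remembers the direction of the last step, which is all that the turn
count needs from the past. This and the next three identities are the entries of the transfer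
matrix. -/
theorem turns_right_right {ε : ℝ} (hε : 0 < ε) (p : ℝ × ℝ) (l : List (ℝ × ℝ)) :
    turns ((p - (ε, ε)) :: p :: (p + (ε, ε)) :: l) = turns (p :: (p + (ε, ε)) :: l) := by
  have h : ¬ Orthogonal (p + (ε, ε) - p) (p - (ε, ε) - p) := by
    simp only [Orthogonal, Prod.fst_sub, Prod.snd_sub, Prod.fst_add, Prod.snd_add]
    nlinarith
  simp only [turns, h, if_false, zero_add]

theorem turns_right_left {ε : ℝ} (p : ℝ × ℝ) (l : List (ℝ × ℝ)) :
    turns ((p - (ε, ε)) :: p :: (p + (-ε, ε)) :: l) = turns (p :: (p + (-ε, ε)) :: l) + 1 := by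
  have h : Orthogonal (p + (-ε, ε) - p) (p - (ε, ε) - p) := by
    simp only [Orthogonal, Prod.fst_sub, Prod.snd_sub, Prod.fst_add, Prod.snd_add]
    ring
  simp only [turns, h, if_true]
  ring

theorem turns_left_right {ε : ℝ} (p : ℝ × ℝ) (l : List (ℝ × ℝ)) :
    turns ((p - (-ε, ε)) :: p :: (p + (ε, ε)) :: l) = turns (p :: (p + (ε, ε)) :: l) + 1 := by
  have h : Orthogonal (p + (ε, ε) - p) (p - (-ε, ε) - p) := by
    simp only [Orthogonal, Prod.fst_sub, Prod.snd_sub, Prod.fst_add, Prod.snd_add]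
    ring
  simp only [turns, h, if_true]
  ring

theorem turns_left_left {ε : ℝ} (hε : 0 < ε) (p : ℝ × ℝ) (l : List (ℝ × ℝ)) :
    turns ((p - (-ε, ε)) :: p :: (p + (-ε, ε)) :: l) = turns (p :: (p + (-ε, ε)) :: l) := by
  have h : ¬ Orthogonal (p + (-ε, ε) - p) (p - (-ε, ε) - p) := by
    simp only [Orthogonal, Prod.fst_sub, Prod.snd_sub, Prod.fst_add, Prod.snd_add]
    nlinarith
  simp only [turns, h, if_false, zero_add]

theorem finsum_continuations_zero {ε : ℝ} (hε : 0 < ε) (p : ℝ × ℝ) (K : ℤ)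
    (f : List (ℝ × ℝ) → ℂ) :
    ∑ᶠ l ∈ continuations ε p 0 (p + (K * ε, 0)), f l = if K = 0 then f [] else 0 := by
  split_ifs with h
  · have h1 : continuations ε p 0 (p + (K * ε, 0)) = {[]} := by
      ext l
      simp only [continuations, h, Set.mem_ofPred_eq, List.length_eq_zero_iff,
        Set.mem_singleton_iff]
      constructor
      · exact fun hl => hl.2.1
      · rintro rfl
        simp
    rw [h1, finsum_mem_singleton]
  · have h1 : continuations ε p 0 (p + (K * ε, 0)) = ∅ := by
      ext l
      simp only [continuations, Set.mem_ofPred_eq, List.length_eq_zero_iff,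
        Set.mem_empty_iff_false, iff_false]
      rintro ⟨_, rfl, h3⟩
      simp only [List.getLast?_singleton, Option.some.injEq] at h3
      have h4 := congrArg Prod.fst h3
      simp [h, hε.ne'] at h4
    rw [h1, finsum_mem_empty]

theorem integral_combination (u v : ℂ) (f g : ℝ → ℂ) (hf : Continuous f) (hg : Continuous g)
    (a b : ℝ) :
    u * (∫ θ in a..b, f θ) + v * (∫ θ in a..b, g θ) = ∫ θ in a..b, (u * f θ + v * g θ) := by
  rw [intervalIntegral.integral_add ((hf.intervalIntegrable _ _).const_mul _)
    ((hg.intervalIntegrable _ _).const_mul _), intervalIntegral.integral_const_mul,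
    intervalIntegral.integral_const_mul]

/-- Splitting by the next step reproduces the recursion of `stepFourier`; the factors `exp(±iθ)`
shift `K` by one. The parity of `K + n` is preserved, and reduces the base case to orthogonality of
even harmonics. -/
theorem finsum_continuations {ε : ℝ} (hε : 0 < ε) (w : ℂ) (n : ℕ) (p : ℝ × ℝ) (K : ℤ)
    (hK : Even (K + n)) :
    (∑ᶠ l ∈ continuations ε p n (p + (K * ε, n * ε)), w ^ turns ((p - (ε, ε)) :: p :: l) =
      1 / Real.pi * ∫ θ in (-(Real.pi / 2))..(Real.pi / 2),
        Complex.exp (-(K * (θ * Complex.I))) * (stepFourier w θ n).1) ∧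
    (∑ᶠ l ∈ continuations ε p n (p + (K * ε, n * ε)), w ^ turns ((p - (-ε, ε)) :: p :: l) =
      1 / Real.pi * ∫ θ in (-(Real.pi / 2))..(Real.pi / 2),
        Complex.exp (-(K * (θ * Complex.I))) * (stepFourier w θ n).2) := by
  have hpi : (Real.pi : ℂ) ≠ 0 := by exact_mod_cast Real.pi_ne_zero
  induction n generalizing p K with
  | zero =>
    have hK' : Even K := by simpa using hK
    simp only [Nat.cast_zero, zero_mul, finsum_continuations_zero hε, stepFourier, mul_one,
      integral_exp_even K hK', turns, pow_zero]
    split_ifs <;> simp [hpi]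
  | succ n ih =>
    have hr := ih (p + (ε, ε)) (K - 1) (by
      have : K + (n + 1 : ℕ) = (K - 1 + n) + 2 := by push_cast; ring
      rw [this] at hK
      exact (Int.even_add.1 hK).2 even_two)
    have hl := ih (p + (-ε, ε)) (K + 1) (by
      have : K + (n + 1 : ℕ) = K + 1 + n := by push_cast; ring
      rwa [this] at hK)
    have hyr : p + (ε, ε) + (((K - 1 : ℤ) : ℝ) * ε, n * ε) =
        p + (K * ε, ((n + 1 : ℕ) : ℝ) * ε) := by
      ext <;> simp <;> ring
    have hyl : p + (-ε, ε) + (((K + 1 : ℤ) : ℝ) * ε, n * ε) =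
        p + (K * ε, ((n + 1 : ℕ) : ℝ) * ε) := by
      ext <;> simp <;> ring
    rw [hyr, add_sub_cancel_right] at hr
    rw [hyl, add_sub_cancel_right] at hl
    have hcr : Continuous fun θ : ℝ => Complex.exp (-(((K - 1 : ℤ) : ℂ) * (θ * Complex.I))) *
        (stepFourier w θ n).1 :=
      (by fun_prop : Continuous fun θ : ℝ =>
        Complex.exp (-(((K - 1 : ℤ) : ℂ) * (θ * Complex.I)))).mul
        (continuous_stepFourier w n).fst
    have hcl : Continuous fun θ : ℝ => Complex.exp (-(((K + 1 : ℤ) : ℂ) * (θ * Complex.I))) *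
        (stepFourier w θ n).2 :=
      (by fun_prop : Continuous fun θ : ℝ =>
        Complex.exp (-(((K + 1 : ℤ) : ℂ) * (θ * Complex.I)))).mul
        (continuous_stepFourier w n).snd
    have her : ∀ θ : ℝ, Complex.exp (-(((K - 1 : ℤ) : ℂ) * (θ * Complex.I))) =
        Complex.exp (-(K * (θ * Complex.I))) * Complex.exp (θ * Complex.I) := fun θ => by
      rw [← Complex.exp_add]
      congr 1
      push_cast
      ring
    have hel : ∀ θ : ℝ, Complex.exp (-(((K + 1 : ℤ) : ℂ) * (θ * Complex.I))) =
        Complex.exp (-(K * (θ * Complex.I))) * Complex.exp (-(θ * Complex.I)) := fun θ => by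
      rw [← Complex.exp_add]
      congr 1
      push_cast
      ring
    rw [finsum_continuations_succ hε, finsum_continuations_succ hε]
    simp only [turns_right_right hε, turns_right_left, turns_left_right, turns_left_left hε,
      pow_succ', ← mul_finsum_mem]
    rw [hr.1, hl.2]
    constructor
    · trans 1 / (Real.pi : ℂ) * (1 * (∫ θ in (-(Real.pi / 2))..(Real.pi / 2),
        Complex.exp (-(((K - 1 : ℤ) : ℂ) * (θ * Complex.I))) * (stepFourier w θ n).1) +
        w * (∫ θ in (-(Real.pi / 2))..(Real.pi / 2),
        Complex.exp (-(((K + 1 : ℤ) : ℂ) * (θ * Complex.I))) * (stepFourier w θ n).2))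
      · ring
      · rw [integral_combination _ _ _ _ hcr hcl]
        congr 2
        ext θ
        rw [her, hel, stepFourier]
        ring
    · trans 1 / (Real.pi : ℂ) * (w * (∫ θ in (-(Real.pi / 2))..(Real.pi / 2),
        Complex.exp (-(((K - 1 : ℤ) : ℂ) * (θ * Complex.I))) * (stepFourier w θ n).1) +
        1 * (∫ θ in (-(Real.pi / 2))..(Real.pi / 2),
        Complex.exp (-(((K + 1 : ℤ) : ℂ) * (θ * Complex.I))) * (stepFourier w θ n).2))
      · ring
      · rw [integral_combination _ _ _ _ hcr hcl]
        congr 2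
        ext θ
        rw [her, hel, stepFourier]
        ring

theorem lattice_of_isStep {ε : ℝ} (hε : 0 < ε) {p q : ℝ × ℝ} (hp : p ∈ lattice ε)
    (h : IsStep ε p q) : q ∈ lattice ε := by
  obtain ⟨⟨k, hk⟩, l, hl⟩ := hp
  rcases (isStep_iff ε p q).1 h with rfl | rfl
  · exact ⟨⟨k + 1, by simp [add_div, hk, hε.ne']⟩, l + 1, by simp [add_div, hl, hε.ne']⟩
  · exact ⟨⟨k - 1, by simp [add_div, hk, hε.ne']; ring⟩,
      l + 1, by simp [add_div, hl, hε.ne']⟩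

theorem mem_lattice_of_isChain {ε : ℝ} (hε : 0 < ε) (s : List (ℝ × ℝ)) (p : ℝ × ℝ)
    (hp : p ∈ lattice ε) (hc : (p :: s).IsChain (IsStep ε)) : ∀ q ∈ p :: s, q ∈ lattice ε := by
  induction s generalizing p with
  | nil => simpa using hp
  | cons r s ih =>
    rw [List.isChain_cons_cons] at hc
    intro q hq
    rcases List.mem_cons.1 hq with rfl | hq
    · exact hp
    · exact ih r (lattice_of_isStep hε hp hc.1) hc.2 q hq

/-- The first step is prescribed, so `n` free steps remain, and lattice membership is automatic for
a chain that starts at the origin. -/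
theorem pathsTo_eq_image {ε : ℝ} (hε : 0 < ε) (x : ℝ) (n : ℕ) :
    pathsTo x ((n + 1) * ε) ε =
      (fun l => (0, 0) :: (ε, ε) :: l) '' continuations ε (ε, ε) n (x, (n + 1) * ε) := by
  ext s
  constructor
  · rintro ⟨⟨_, hc⟩, h0, h1, hl⟩
    match s, h0, h1 with
    | p :: q :: l, h0, h1 =>
      obtain rfl : p = (0, 0) := by simpa using h0
      obtain rfl : q = (ε, ε) := by simpa using h1
      rw [List.isChain_cons_cons] at hc
      rw [List.getLast?_cons_cons] at hl
      refine ⟨l, ⟨hc.2, ?_, hl⟩, rfl⟩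
      have h := chain_getLast_snd ε l _ _ hc.2 hl
      simp only at h
      have h2 : (n : ℝ) * ε = l.length * ε := by linarith
      exact_mod_cast (mul_right_cancel₀ hε.ne' h2).symm
  · rintro ⟨l, ⟨hc, hn, hl⟩, rfl⟩
    have hc' : ((0, 0) :: (ε, ε) :: l).IsChain (IsStep ε) := by
      rw [List.isChain_cons_cons]
      exact ⟨Or.inl (by simp), hc⟩
    refine ⟨⟨mem_lattice_of_isChain hε _ _ ⟨⟨0, by simp⟩, 0, by simp⟩ hc', hc'⟩, rfl, rfl, ?_⟩
    rw [List.getLast?_cons_cons]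
    exact hl

/-- The Fourier representation of the sum over checker paths. -/
theorem finsum_pathsTo {ε : ℝ} (hε : 0 < ε) (w : ℂ) (n : ℕ) (K : ℤ) (hK : Even (K + n)) :
    ∑ᶠ s ∈ pathsTo ((K + 1) * ε) ((n + 1) * ε) ε, w ^ turns s =
      1 / Real.pi * ∫ θ in (-(Real.pi / 2))..(Real.pi / 2),
        Complex.exp (-(K * (θ * Complex.I))) * (stepFourier w θ n).1 := by
  rw [pathsTo_eq_image hε, finsum_mem_image]
  · have h := (finsum_continuations hε w n (ε, ε) K hK).1
    have h1 : ((ε, ε) : ℝ × ℝ) + (K * ε, n * ε) = ((K + 1) * ε, (n + 1) * ε) := by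
      ext <;> simp <;> ring
    have h2 : ((ε, ε) : ℝ × ℝ) - (ε, ε) = (0, 0) := sub_self _
    rw [h1, h2] at h
    exact h
  · intro l _ l' _ h
    simpa using h

/-! ### Powers of the transfer matrix -/

theorem stepFourier_zero_fst (θ : ℝ) (n : ℕ) :
    (stepFourier 0 θ n).1 = Complex.exp (n * (θ * Complex.I)) := by
  induction n with
  | zero => simp [stepFourier]
  | succ n ih =>
    simp only [stepFourier, ih, zero_mul, add_zero, ← Complex.exp_add]
    congr 1
    push_cast
    ring

/-- The transfer matrix multiplied by `c` has determinant `c²(1 - w²) = 1` and trace `2 cos ω`. By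
Cayley–Hamilton its `n`th power is `cos nω + (sin nω / sin ω)(cM - cos ω)`, applied here to the
vector `(1, 1)`. -/
theorem stepFourier_closed (w : ℂ) (θ : ℝ) (c ω : ℂ) (hc : c ^ 2 * (1 - w ^ 2) = 1)
    (hω : Complex.cos ω = c * Complex.cos θ) (hs : Complex.sin ω ≠ 0) (n : ℕ) :
    c ^ n * (stepFourier w θ n).1 = Complex.cos (n * ω) + Complex.sin (n * ω) / Complex.sin ω *
      (c * (Complex.exp (θ * Complex.I) + w * Complex.exp (-(θ * Complex.I)) - Complex.cos θ)) ∧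
    c ^ n * (stepFourier w θ n).2 = Complex.cos (n * ω) + Complex.sin (n * ω) / Complex.sin ω *
      (c * (w * Complex.exp (θ * Complex.I) + Complex.exp (-(θ * Complex.I)) -
        Complex.cos θ)) := by
  have hcos : Complex.cos θ =
      (Complex.exp (θ * Complex.I) + Complex.exp (-(θ * Complex.I))) / 2 := by
    rw [Complex.cos, neg_mul]
  have hz : Complex.exp (θ * Complex.I) * Complex.exp (-(θ * Complex.I)) = 1 := by
    rw [← Complex.exp_add]; simp
  have hsq := Complex.sin_sq_add_cos_sq ω
  induction n with
  | zero => simp [stepFourier]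
  | succ n ih =>
    obtain ⟨h1, h2⟩ := ih
    have hcs : Complex.cos ((n + 1 : ℕ) * ω) =
        Complex.cos (n * ω) * Complex.cos ω - Complex.sin (n * ω) * Complex.sin ω := by
      rw [← Complex.cos_add]; push_cast; ring_nf
    have hsn : Complex.sin ((n + 1 : ℕ) * ω) =
        Complex.sin (n * ω) * Complex.cos ω + Complex.cos (n * ω) * Complex.sin ω := by
      rw [← Complex.sin_add]; push_cast; ring_nf
    rw [hcs, hsn]
    simp only [stepFourier]
    rw [hcos] at h1 h2 hω ⊢
    generalize Complex.exp (θ * Complex.I) = z at *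
    generalize Complex.exp (-(θ * Complex.I)) = z' at *
    generalize Complex.cos (n * ω) = C at *
    generalize Complex.sin (n * ω) = S at *
    generalize Complex.cos ω = D at *
    generalize Complex.sin ω = s at *
    generalize (stepFourier w θ n).1 = G at *
    generalize (stepFourier w θ n).2 = H at *
    subst hω
    obtain ⟨R, rfl⟩ : ∃ R, S = R * s := ⟨S / s, (div_mul_cancel₀ S hs).symm⟩
    rw [mul_div_cancel_right₀ R hs] at h1 h2
    rw [show ∀ u : ℂ, (R * s * u + C * s) / s = R * u + C from fun u => by field_simp]
    constructor
    · trans c * (z * (c ^ n * G) + w * z' * (c ^ n * H))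
      · ring
      · rw [h1, h2]
        linear_combination R * hsq + R * c ^ 2 * (w ^ 2 - 1) * hz - R * hc
    · trans c * (w * z * (c ^ n * G) + z' * (c ^ n * H))
      · ring
      · rw [h1, h2]
        linear_combination R * hsq + R * c ^ 2 * (w ^ 2 - 1) * hz - R * hc

/-! ### Oscillatory and Fresnel integrals -/

/-- The first derivative test of van der Corput, for a convex phase and an amplitude whose
variation is controlled by `V`. -/
theorem norm_integral_mul_exp_le {a b : ℝ} (hab : a ≤ b) {φ φ' φ'' V V' : ℝ → ℝ} {A A' : ℝ → ℂ}
    {κ : ℂ} (hκ : κ ≠ 0) {l M W : ℝ} (hl : 0 < l)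
    (hφ : ∀ θ, HasDerivAt φ (φ' θ) θ) (hφ' : ∀ θ, HasDerivAt φ' (φ'' θ) θ)
    (hA : ∀ θ, HasDerivAt A (A' θ) θ) (hV : ∀ θ, HasDerivAt V (V' θ) θ)
    (cφ'' : Continuous φ'') (cA' : Continuous A') (cV' : Continuous V')
    (hconv : ∀ θ ∈ Set.Icc a b, 0 ≤ φ'' θ) (hlower : ∀ θ ∈ Set.Icc a b, l ≤ |φ' θ|)
    (hexp : ∀ θ ∈ Set.Icc a b, ‖Complex.exp (κ * φ θ)‖ ≤ 1)
    (hM : ∀ θ ∈ Set.Icc a b, ‖A θ‖ ≤ M) (hAV : ∀ θ ∈ Set.Icc a b, ‖A' θ‖ ≤ V' θ)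
    (hW : V b - V a ≤ W) :
    ‖∫ θ in a..b, A θ * Complex.exp (κ * φ θ)‖ ≤ (4 * M + W) / (l * ‖κ‖) := by
  have cφ : Continuous φ := continuous_iff_continuousAt.2 fun θ => (hφ θ).continuousAt
  have cφ' : Continuous φ' := continuous_iff_continuousAt.2 fun θ => (hφ' θ).continuousAt
  have cA : Continuous A := continuous_iff_continuousAt.2 fun θ => (hA θ).continuousAt
  have hne : ∀ θ ∈ Set.Icc a b, φ' θ ≠ 0 := fun θ hθ h => by
    have := hlower θ hθ
    rw [h, abs_zero] at this
    linarith
  have hneC : ∀ θ ∈ Set.Icc a b, (φ' θ : ℂ) ≠ 0 := fun θ hθ => by exact_mod_cast hne θ hθ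
  have hκ' : 0 < ‖κ‖ := norm_pos_iff.2 hκ
  have hM0 : 0 ≤ M := (norm_nonneg _).trans (hM a (Set.left_mem_Icc.2 hab))
  have huIcc : Set.uIcc a b = Set.Icc a b := Set.uIcc_of_le hab
  -- Integration by parts: `F` is the boundary term, and its derivative is the integrand plus the
  -- remainder `R`.
  set F : ℝ → ℂ := fun θ => A θ * Complex.exp (κ * φ θ) / (κ * φ' θ) with hF
  set R : ℝ → ℂ := fun θ => (A' θ / φ' θ - A θ * φ'' θ / (φ' θ : ℂ) ^ 2) / κ *
    Complex.exp (κ * φ θ) with hR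
  have hFd : ∀ θ ∈ Set.uIcc a b, HasDerivAt F (A θ * Complex.exp (κ * φ θ) + R θ) θ := by
    intro θ hθ
    rw [huIcc] at hθ
    have h1 : HasDerivAt (fun θ => Complex.exp (κ * φ θ)) _ θ :=
      (((hφ θ).ofReal_comp).const_mul κ).cexp
    have h2 : HasDerivAt (fun θ => κ * (φ' θ : ℂ)) _ θ := ((hφ' θ).ofReal_comp).const_mul κ
    have h3 := ((hA θ).mul h1).div h2 (mul_ne_zero hκ (hneC θ hθ))
    refine h3.congr_deriv ?_
    have := hneC θ hθ
    simp only [hR, Pi.mul_apply]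
    field_simp
    ring
  have cE : Continuous fun θ => Complex.exp (κ * φ θ) := by fun_prop
  have cmain : Continuous fun θ => A θ * Complex.exp (κ * φ θ) := cA.mul cE
  have cR : ContinuousOn R (Set.Icc a b) := by
    refine ((ContinuousOn.sub (ContinuousOn.div ?_ ?_ hneC) (ContinuousOn.div ?_ ?_ ?_)).div_const
      κ).mul cE.continuousOn
    · exact cA'.continuousOn
    · fun_prop
    · fun_prop
    · fun_prop
    · exact fun θ hθ => pow_ne_zero 2 (hneC θ hθ)
  have iR : IntervalIntegrable R MeasureTheory.volume a b :=
    (huIcc ▸ cR).intervalIntegrable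
  have imain := cmain.intervalIntegrable (μ := MeasureTheory.volume) a b
  have hparts := intervalIntegral.integral_eq_sub_of_hasDerivAt hFd (imain.add iR)
  rw [intervalIntegral.integral_add imain iR] at hparts
  -- Convexity makes `|φ''|/φ'²` the exact derivative of `-1/φ'`, so the majorant `B` of `‖R‖`
  -- integrates explicitly.
  set B : ℝ → ℝ := fun θ => (V' θ / l + M * (φ'' θ / φ' θ ^ 2)) / ‖κ‖ with hB
  have cB2 : ContinuousOn (fun θ => φ'' θ / φ' θ ^ 2) (Set.Icc a b) :=
    cφ''.continuousOn.div (by fun_prop) fun θ hθ => pow_ne_zero 2 (hne θ hθ)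
  have iB : IntervalIntegrable B MeasureTheory.volume a b := by
    refine ContinuousOn.intervalIntegrable (huIcc ▸ ?_)
    exact (((cV'.div_const l).continuousOn).add (continuousOn_const.mul cB2)).div_const _
  have hBd : ∀ θ ∈ Set.uIcc a b,
      HasDerivAt (fun θ => (V θ / l - M * (φ' θ)⁻¹) / ‖κ‖) (B θ) θ := by
    intro θ hθ
    rw [huIcc] at hθ
    have h3 := ((((hV θ).div_const l).sub (((hφ' θ).inv (hne θ hθ)).const_mul M))).div_const ‖κ‖
    refine h3.congr_deriv ?_
    simp only [hB]
    ring
  have hBint := intervalIntegral.integral_eq_sub_of_hasDerivAt hBd iB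
  have hRB : ‖∫ θ in a..b, R θ‖ ≤ ∫ θ in a..b, B θ := by
    refine intervalIntegral.norm_integral_le_of_norm_le hab (Eventually.of_forall ?_) iB
    intro θ hθ
    have hθ' := Set.Ioc_subset_Icc_self hθ
    have hlow := hlower θ hθ'
    have hpos : 0 < |φ' θ| := hl.trans_le hlow
    simp only [hR, hB]
    rw [norm_mul, norm_div]
    refine (mul_le_of_le_one_right (by positivity) (hexp θ hθ')).trans ?_
    gcongr
    refine (norm_sub_le _ _).trans ?_
    rw [norm_div, norm_div, norm_mul, norm_pow, Complex.norm_real, Complex.norm_real,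
      Real.norm_eq_abs, Real.norm_eq_abs, sq_abs, abs_of_nonneg (hconv θ hθ'), mul_div_assoc]
    have := hconv θ hθ'
    gcongr
    · exact (norm_nonneg _).trans (hAV θ hθ')
    · exact hAV θ hθ'
    · exact hM θ hθ'
  have hFb : ∀ θ ∈ Set.Icc a b, ‖F θ‖ ≤ M / (l * ‖κ‖) := by
    intro θ hθ
    have hlow := hlower θ hθ
    simp only [hF]
    rw [norm_div, norm_mul, norm_mul, Complex.norm_real, Real.norm_eq_abs, mul_comm ‖κ‖]
    gcongr
    calc _ ≤ M * 1 := mul_le_mul (hM θ hθ) (hexp θ hθ) (norm_nonneg _) hM0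
      _ = M := mul_one M
  have hinv : ∀ θ ∈ Set.Icc a b, |(φ' θ)⁻¹| ≤ 1 / l := by
    intro θ hθ
    rw [abs_inv, ← one_div]
    exact one_div_le_one_div_of_le hl (hlower θ hθ)
  have ha := Set.left_mem_Icc.2 hab
  have hb := Set.right_mem_Icc.2 hab
  have hBle : ∫ θ in a..b, B θ ≤ (2 * M + W) / (l * ‖κ‖) := by
    rw [hBint]
    have h1 := (abs_le.1 (hinv a ha)).2
    have h2 := (abs_le.1 (hinv b hb)).1
    have h3 : (V b - V a) / l ≤ W / l := by gcongr
    have h4 : M * ((φ' a)⁻¹ - (φ' b)⁻¹) ≤ M * (1 / l + 1 / l) := by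
      gcongr
      linarith
    calc _ = ((V b - V a) / l + M * ((φ' a)⁻¹ - (φ' b)⁻¹)) / ‖κ‖ := by ring
      _ ≤ (W / l + M * (1 / l + 1 / l)) / ‖κ‖ := by gcongr
      _ = _ := by field_simp; ring
  have hmain : ∫ θ in a..b, A θ * Complex.exp (κ * φ θ) = F b - F a - ∫ θ in a..b, R θ := by
    rw [← hparts]
    ring
  rw [hmain]
  calc _ ≤ ‖F b‖ + ‖F a‖ + ‖∫ θ in a..b, R θ‖ :=
        (norm_sub_le _ _).trans (by gcongr; exact norm_sub_le _ _)
    _ ≤ M / (l * ‖κ‖) + M / (l * ‖κ‖) + (2 * M + W) / (l * ‖κ‖) := by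
        gcongr
        · exact hFb b hb
        · exact hFb a ha
        · exact hRB.trans hBle
    _ = _ := by ring

theorem norm_integral_gaussian_tail_le {b : ℂ} (hb : 0 ≤ b.re) (hb0 : b ≠ 0) {K r s : ℝ}
    (hK : 0 < K) (hrs : r ≤ s) (h : K ≤ r ∨ s ≤ -K) :
    ‖∫ u in r..s, Complex.exp (-b * (u : ℂ) ^ 2)‖ ≤ 2 / (‖b‖ * K) := by
  have hder : ∀ θ : ℝ, HasDerivAt (fun u : ℝ => u ^ 2) (2 * θ) θ := fun θ => by
    simpa using hasDerivAt_pow 2 θ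
  have hder' : ∀ θ : ℝ, HasDerivAt (fun u : ℝ => 2 * u) 2 θ := fun θ => by
    simpa using (hasDerivAt_id θ).const_mul 2
  have := norm_integral_mul_exp_le hrs (neg_ne_zero.2 hb0) (l := 2 * K) (M := 1) (W := 0)
    (by positivity) hder hder' (fun θ => hasDerivAt_const θ (1 : ℂ))
    (fun θ => hasDerivAt_const θ (0 : ℝ)) continuous_const continuous_const continuous_const
    (fun _ _ => by norm_num) (fun θ hθ => ?_) (fun θ hθ => ?_) (by simp) (by simp) (by simp)
  · simp only [one_mul, Complex.ofReal_pow, norm_neg] at this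
    refine this.trans (le_of_eq ?_)
    have : ‖b‖ ≠ 0 := norm_ne_zero_iff.2 hb0
    field_simp
    norm_num
  · rw [abs_mul, abs_two]
    rcases h with h | h
    · have := le_abs_self θ
      linarith [hθ.1]
    · have := neg_abs_le θ
      linarith [hθ.2]
  · rw [Complex.norm_exp, Real.exp_le_one_iff]
    have : (-b * ((θ ^ 2 : ℝ) : ℂ)).re = -(b.re * θ ^ 2) := by
      rw [Complex.re_mul_ofReal, Complex.neg_re]; ring
    rw [this]
    nlinarith [sq_nonneg θ, mul_nonneg hb (sq_nonneg θ)]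

/-- The error depends on `‖b‖` and not on the real part of `b`, so it survives the passage to
imaginary `b`. -/
theorem norm_integral_gaussian_sub_le {b : ℂ} (hb : 0 < b.re) {K : ℝ} (hK : 0 < K) :
    ‖(∫ u in (-K)..K, Complex.exp (-b * (u : ℂ) ^ 2)) - (Real.pi / b) ^ (1 / 2 : ℂ)‖ ≤
      4 / (‖b‖ * K) := by
  have hb0 : b ≠ 0 := by
    rintro rfl
    simp at hb
  have hlim := MeasureTheory.intervalIntegral_tendsto_integral (μ := MeasureTheory.volume)
    (integrable_cexp_neg_mul_sq hb) tendsto_neg_atTop_atBot tendsto_id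
  rw [integral_gaussian_complex hb] at hlim
  refine le_of_tendsto (hlim.const_sub _).norm ?_
  filter_upwards [eventually_ge_atTop K] with s hs
  have hint : ∀ c d : ℝ, IntervalIntegrable (fun u : ℝ => Complex.exp (-b * (u : ℂ) ^ 2))
      MeasureTheory.volume c d := fun c d => Continuous.intervalIntegrable (by fun_prop) c d
  have hsplit : (∫ u in (-s)..(id s), Complex.exp (-b * (u : ℂ) ^ 2)) =
      (∫ u in (-s)..(-K), Complex.exp (-b * (u : ℂ) ^ 2)) +
      (∫ u in (-K)..K, Complex.exp (-b * (u : ℂ) ^ 2)) +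
      ∫ u in K..s, Complex.exp (-b * (u : ℂ) ^ 2) := by
    rw [intervalIntegral.integral_add_adjacent_intervals (hint _ _) (hint _ _),
      intervalIntegral.integral_add_adjacent_intervals (hint _ _) (hint _ _), id]
  have h1 := norm_integral_gaussian_tail_le hb.le hb0 hK (neg_le_neg hs) (Or.inr le_rfl)
  have h2 := norm_integral_gaussian_tail_le hb.le hb0 hK hs (Or.inl le_rfl)
  rw [hsplit]
  calc _ = ‖-(∫ u in (-s)..(-K), Complex.exp (-b * (u : ℂ) ^ 2)) -
        ∫ u in K..s, Complex.exp (-b * (u : ℂ) ^ 2)‖ := by congr 1; ring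
    _ ≤ _ := norm_sub_le _ _
    _ ≤ 2 / (‖b‖ * K) + 2 / (‖b‖ * K) := by
        rw [norm_neg]
        gcongr
    _ = _ := by ring

/-- The Fresnel integral with its remainder. -/
theorem norm_integral_fresnel_sub_le {r : ℝ} (hr : r ≠ 0) {K : ℝ} (hK : 0 < K) :
    ‖(∫ u in (-K)..K, Complex.exp (-(r * Complex.I) * (u : ℂ) ^ 2)) -
      (Real.pi / (r * Complex.I)) ^ (1 / 2 : ℂ)‖ ≤ 4 / (|r| * K) := by
  have hb0 : (r * Complex.I : ℂ) ≠ 0 := by simp [hr]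
  -- The imaginary parameter is approached from the right half-plane, where the Gaussian integral
  -- converges absolutely.
  set b : ℕ → ℂ := fun k => r * Complex.I + ((1 / ((k : ℝ) + 1) : ℝ) : ℂ) with hb
  have hbl : Tendsto b atTop (𝓝 (r * Complex.I)) := by
    have h := ((Complex.continuous_ofReal.tendsto 0).comp
      tendsto_one_div_add_atTop_nhds_zero_nat).const_add (r * Complex.I : ℂ)
    simpa [hb] using h
  have hcont : Continuous fun b : ℂ => ∫ u in (-K)..K, Complex.exp (-b * (u : ℂ) ^ 2) :=
    intervalIntegral.continuous_parametric_intervalIntegral_of_continuous' (by fun_prop) _ _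
  have hpow : ContinuousAt (fun b : ℂ => (Real.pi / b) ^ (1 / 2 : ℂ)) (r * Complex.I) := by
    refine ContinuousAt.cpow (continuousAt_const.div continuousAt_id hb0) continuousAt_const ?_
    -- The base of the power is a nonzero imaginary number, hence off the branch cut.
    right
    have : (Real.pi / (r * Complex.I) : ℂ) = ((-(Real.pi / r) : ℝ) : ℂ) * Complex.I := by
      have : (r : ℂ) ≠ 0 := by exact_mod_cast hr
      push_cast
      field_simp
      simp
    rw [this]
    simp [hr, Real.pi_ne_zero]
  have hnorm : ‖(r * Complex.I : ℂ)‖ = |r| := by simp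
  have hL := (((hcont.tendsto _).comp hbl).sub (hpow.tendsto.comp hbl)).norm
  have hRt : Tendsto (fun k => 4 / (‖b k‖ * K)) atTop (𝓝 (4 / (|r| * K))) := by
    rw [← hnorm]
    exact tendsto_const_nhds.div (hbl.norm.mul_const K) (by rw [hnorm]; positivity)
  refine le_of_tendsto_of_tendsto' hL hRt fun k => ?_
  refine norm_integral_gaussian_sub_le ?_ hK
  simp only [hb, Complex.add_re, Complex.ofReal_re]
  simp
  positivity

theorem fresnel_value {m : ℝ} (hm : 0 < m) :
    (Real.pi / (((1 / (2 * m) : ℝ) : ℂ) * Complex.I)) ^ (1 / 2 : ℂ) =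
      (Real.sqrt (2 * Real.pi * m) : ℂ) * Complex.exp (-(Complex.I * Real.pi / 4)) := by
  have h0 : (0 : ℝ) < 2 * Real.pi * m := by positivity
  have hmC : (m : ℂ) ≠ 0 := by exact_mod_cast hm.ne'
  have h1 : (Real.pi / (((1 / (2 * m) : ℝ) : ℂ) * Complex.I)) =
      ((2 * Real.pi * m : ℝ) : ℂ) * (-Complex.I) := by
    push_cast
    field_simp
    simp
  rw [h1, Complex.cpow_def_of_ne_zero (by simp [hm.ne', Real.pi_ne_zero]),
    Complex.log_ofReal_mul h0 (by simp), Complex.log_neg_I, add_mul, Complex.exp_add,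
    Real.sqrt_eq_rpow, Complex.ofReal_cpow h0.le,
    Complex.cpow_def_of_ne_zero (by exact_mod_cast h0.ne'), Complex.ofReal_log h0.le]
  congr 2
  · push_cast; ring
  · ring

/-! ### Dispersion relation and its continuum limit -/

/-- `√(μ² + sin² θ)` -/
noncomputable def energy (μ θ : ℝ) : ℝ := Real.sqrt (μ ^ 2 + Real.sin θ ^ 2)

/-- The frequency `ω` of the lattice wave with wave number `θ`: `cos ω = cos θ / √(1 + μ²)`. -/
noncomputable def freq (μ θ : ℝ) : ℝ := Real.arccos (Real.cos θ / Real.sqrt (1 + μ ^ 2))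

/-- The group velocity, that is, the derivative of the frequency. -/
noncomputable def velocity (μ θ : ℝ) : ℝ := Real.sin θ / energy μ θ

/-- The angle with sine `velocity μ θ` and cosine `μ / energy μ θ`. -/
noncomputable def velocityAngle (μ θ : ℝ) : ℝ := Real.arctan (Real.sin θ / μ)

variable {μ : ℝ}

theorem energy_pos (hμ : 0 < μ) (θ : ℝ) : 0 < energy μ θ :=
  Real.sqrt_pos.2 (by positivity)

theorem energy_sq (μ θ : ℝ) : energy μ θ ^ 2 = μ ^ 2 + Real.sin θ ^ 2 :=
  Real.sq_sqrt (by positivity)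

theorem energy_eq (hμ : 0 < μ) (θ : ℝ) :
    energy μ θ = μ * Real.sqrt (1 + (Real.sin θ / μ) ^ 2) := by
  rw [energy, show μ ^ 2 + Real.sin θ ^ 2 = μ ^ 2 * (1 + (Real.sin θ / μ) ^ 2) by field_simp,
    Real.sqrt_mul (by positivity), Real.sqrt_sq hμ.le]

theorem continuous_energy (μ : ℝ) : Continuous (energy μ) := by
  unfold energy
  fun_prop

theorem sin_velocityAngle (hμ : 0 < μ) (θ : ℝ) :
    Real.sin (velocityAngle μ θ) = velocity μ θ := by
  rw [velocityAngle, Real.sin_arctan, velocity, energy_eq hμ, div_div]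

theorem cos_velocityAngle (hμ : 0 < μ) (θ : ℝ) :
    Real.cos (velocityAngle μ θ) = μ / energy μ θ := by
  rw [velocityAngle, Real.cos_arctan, energy_eq hμ]
  field_simp

theorem abs_velocity_le (hμ : 0 < μ) (θ : ℝ) : |velocity μ θ| ≤ 1 := by
  rw [← sin_velocityAngle hμ]
  exact Real.abs_sin_le_one _

theorem cos_freq (μ θ : ℝ) : Real.cos (freq μ θ) = Real.cos θ / Real.sqrt (1 + μ ^ 2) := by
  have h : |Real.cos θ / Real.sqrt (1 + μ ^ 2)| ≤ 1 := by
    rw [abs_div, abs_of_nonneg (Real.sqrt_nonneg _)]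
    refine (div_le_one (Real.sqrt_pos.2 (by positivity))).2 ?_
    exact (Real.abs_cos_le_one θ).trans (Real.one_le_sqrt.2 (by nlinarith [sq_nonneg μ]))
  exact Real.cos_arccos (abs_le.1 h).1 (abs_le.1 h).2

theorem sin_freq (μ θ : ℝ) : Real.sin (freq μ θ) = energy μ θ / Real.sqrt (1 + μ ^ 2) := by
  have h : (0 : ℝ) < 1 + μ ^ 2 := by positivity
  rw [freq, Real.sin_arccos, energy, ← Real.sqrt_div (by positivity), div_pow, Real.sq_sqrt h.le]
  congr 1
  field_simp
  linarith [Real.sin_sq_add_cos_sq θ]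

theorem hasDerivAt_freq (hμ : 0 < μ) (θ : ℝ) : HasDerivAt (freq μ) (velocity μ θ) θ := by
  have h : (0 : ℝ) < Real.sqrt (1 + μ ^ 2) := Real.sqrt_pos.2 (by positivity)
  have hsin : Real.sqrt (1 - (Real.cos θ / Real.sqrt (1 + μ ^ 2)) ^ 2) =
      energy μ θ / Real.sqrt (1 + μ ^ 2) := by
    rw [← sin_freq, freq, Real.sin_arccos]
  have hE := energy_pos hμ θ
  have hne : 1 - (Real.cos θ / Real.sqrt (1 + μ ^ 2)) ^ 2 ≠ 0 := by
    intro h0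
    rw [h0, Real.sqrt_zero] at hsin
    exact (div_pos hE h).ne hsin
  have h1 := (Real.hasDerivAt_arccos (x := Real.cos θ / Real.sqrt (1 + μ ^ 2))
    (fun h => hne (by rw [h]; norm_num)) (fun h => hne (by rw [h]; norm_num))).comp θ
    ((Real.hasDerivAt_cos θ).div_const _)
  refine h1.congr_deriv ?_
  rw [hsin, velocity]
  field_simp

theorem hasDerivAt_energy (hμ : 0 < μ) (θ : ℝ) :
    HasDerivAt (energy μ) (Real.sin θ * Real.cos θ / energy μ θ) θ := by
  have h := (((Real.hasDerivAt_sin θ).pow 2).const_add (μ ^ 2)).sqrt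
    (by simp only [Pi.pow_apply]; positivity)
  refine h.congr_deriv ?_
  have := energy_pos hμ θ
  simp only [energy, Pi.pow_apply] at this ⊢
  field_simp
  push_cast
  ring

theorem hasDerivAt_velocity (hμ : 0 < μ) (θ : ℝ) :
    HasDerivAt (velocity μ) (μ ^ 2 * Real.cos θ / energy μ θ ^ 3) θ := by
  have hE := energy_pos hμ θ
  refine ((Real.hasDerivAt_sin θ).div (hasDerivAt_energy hμ θ) hE.ne').congr_deriv ?_
  have h2 := energy_sq μ θ
  field_simp
  rw [h2]
  ring

theorem hasDerivAt_velocityAngle (hμ : 0 < μ) (θ : ℝ) :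
    HasDerivAt (velocityAngle μ) (μ * Real.cos θ / energy μ θ ^ 2) θ := by
  refine ((Real.hasDerivAt_sin θ).div_const μ).arctan.congr_deriv ?_
  rw [energy_sq]
  have : μ ^ 2 + Real.sin θ ^ 2 ≠ 0 := by positivity
  field_simp

/-- The frequency is convex where the cosine is nonnegative; a lower bound for the slope of the
phase then only has to be checked at one endpoint. -/
theorem monotoneOn_velocity (hμ : 0 < μ) :
    MonotoneOn (velocity μ) (Set.Icc (-(Real.pi / 2)) (Real.pi / 2)) := by
  refine monotoneOn_of_hasDerivWithinAt_nonneg (convex_Icc _ _)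
    (fun θ _ => (hasDerivAt_velocity hμ θ).continuousAt.continuousWithinAt)
    (fun θ _ => (hasDerivAt_velocity hμ θ).hasDerivWithinAt) fun θ hθ => ?_
  have hθ' := interior_subset hθ
  have := Real.cos_nonneg_of_mem_Icc hθ'
  have := energy_pos hμ θ
  positivity

theorem abs_arctan_sub_le (x : ℝ) : |Real.arctan x - x| ≤ |x| ^ 3 := by
  have h := (convex_Icc (-|x|) |x|).norm_image_sub_le_of_norm_hasDerivWithin_le
    (f := fun u => Real.arctan u - u) (f' := fun u => 1 / (1 + u ^ 2) - 1) (C := |x| ^ 2)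
    (fun u _ => ((Real.hasDerivAt_arctan u).sub (hasDerivAt_id u)).hasDerivWithinAt)
    (fun u hu => ?_) (x := 0) (y := x) (by simp) ⟨neg_abs_le x, le_abs_self x⟩
  · simp only [Real.arctan_zero, sub_zero, Real.norm_eq_abs] at h
    calc _ ≤ |x| ^ 2 * |x| := h
      _ = _ := by ring
  · have h1 : 1 / (1 + u ^ 2) - 1 = -(u ^ 2 / (1 + u ^ 2)) := by field_simp; ring
    rw [h1, Real.norm_eq_abs, abs_neg, abs_of_nonneg (by positivity)]
    calc u ^ 2 / (1 + u ^ 2) ≤ u ^ 2 := div_le_self (sq_nonneg u) (by nlinarith [sq_nonneg u])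
      _ ≤ |x| ^ 2 := sq_le_sq' (by linarith [hu.1]) hu.2

theorem freq_zero (hμ : 0 < μ) : freq μ 0 = Real.arctan μ := by
  rw [Real.arctan_eq_arccos hμ.le, freq, Real.cos_zero, one_div]

/-- With `r = sin(εp)/ε` the velocity is exactly `r/√(m² + r²)`. Replacing the root by `m` and then
`r` by `p` costs a cubic error each time, uniformly in `ε ≤ 1`. -/
theorem abs_velocity_sub_le {m ε : ℝ} (hm : 0 < m) (hε : 0 < ε) (hε1 : ε ≤ 1) (p : ℝ) :
    |velocity (m * ε) (ε * p) - p / m| ≤ (1 / m + 1 / m ^ 3) * |p| ^ 3 := by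
  obtain ⟨r, hr⟩ : ∃ r, Real.sin (ε * p) = ε * r :=
    ⟨Real.sin (ε * p) / ε, by field_simp⟩
  have hrp : |p - r| ≤ |p| ^ 3 := by
    have h := Real.abs_sub_sin_le (ε * p)
    rw [hr, ← mul_sub, abs_mul, abs_mul, abs_of_pos hε] at h
    have h2 : |p - r| ≤ ε ^ 2 * |p| ^ 3 / 6 := by
      refine le_of_mul_le_mul_left (h.trans (le_of_eq ?_)) hε
      ring
    have h3 : ε ^ 2 ≤ 1 := pow_le_one₀ hε.le hε1
    have h4 : 0 ≤ |p| ^ 3 := by positivity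
    nlinarith
  have hr1 : |r| ≤ |p| := by
    have h := Real.abs_sin_le_abs (x := ε * p)
    rw [hr, abs_mul, abs_mul] at h
    exact le_of_mul_le_mul_left h (abs_pos.2 hε.ne')
  have hE : energy (m * ε) (ε * p) = ε * Real.sqrt (m ^ 2 + r ^ 2) := by
    rw [energy, hr, show (m * ε) ^ 2 + (ε * r) ^ 2 = ε ^ 2 * (m ^ 2 + r ^ 2) by ring,
      Real.sqrt_mul (by positivity), Real.sqrt_sq hε.le]
  have hv : velocity (m * ε) (ε * p) = r / Real.sqrt (m ^ 2 + r ^ 2) := by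
    rw [velocity, hE, hr, mul_div_mul_left _ _ hε.ne']
  have hq : m ≤ Real.sqrt (m ^ 2 + r ^ 2) :=
    Real.le_sqrt_of_sq_le (by nlinarith [sq_nonneg r])
  have hq2 : Real.sqrt (m ^ 2 + r ^ 2) ^ 2 = m ^ 2 + r ^ 2 := Real.sq_sqrt (by positivity)
  set q := Real.sqrt (m ^ 2 + r ^ 2) with hqdef
  have hq0 : 0 < q := hm.trans_le hq
  have hqm : q - m ≤ r ^ 2 / m := by
    rw [le_div_iff₀ hm]
    nlinarith
  have hfirst : |r / q - r / m| ≤ |p| ^ 3 / m ^ 3 := by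
    have h1 : r / q - r / m = -(r * (q - m) / (q * m)) := by field_simp; ring
    rw [h1, abs_neg, abs_div, abs_mul, abs_of_nonneg (sub_nonneg.2 hq),
      abs_of_pos (mul_pos hq0 hm)]
    calc |r| * (q - m) / (q * m) ≤ |r| * (r ^ 2 / m) / (m * m) := by gcongr
      _ = |r| ^ 3 / m ^ 3 := by
        rw [← sq_abs r]
        field_simp
      _ ≤ _ := by gcongr
  have hsecond : |r / m - p / m| ≤ |p| ^ 3 / m := by
    rw [← sub_div, abs_div, abs_of_pos hm, abs_sub_comm]
    gcongr
  rw [hv]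
  calc |r / q - p / m| ≤ |r / q - r / m| + |r / m - p / m| := abs_sub_le _ _ _
    _ ≤ |p| ^ 3 / m ^ 3 + |p| ^ 3 / m := add_le_add hfirst hsecond
    _ = _ := by ring

/-- The velocity estimate is integrated from `p = 0` by the mean value inequality. The term `m³ε²`
comes from the rest frequency, `arctan(mε)/ε` instead of `m`. -/
theorem abs_freq_sub_le {m ε : ℝ} (hm : 0 < m) (hε : 0 < ε) (hε1 : ε ≤ 1) (p : ℝ) :
    |freq (m * ε) (ε * p) / ε - (m + p ^ 2 / (2 * m))| ≤
      (1 / m + 1 / m ^ 3) * |p| ^ 4 + m ^ 3 * ε ^ 2 := by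
  have hμ : 0 < m * ε := mul_pos hm hε
  have h := (convex_Icc (-|p|) |p|).norm_image_sub_le_of_norm_hasDerivWithin_le
    (f := fun u => freq (m * ε) (ε * u) / ε - u ^ 2 / (2 * m))
    (f' := fun u => velocity (m * ε) (ε * u) - u / m) (C := (1 / m + 1 / m ^ 3) * |p| ^ 3)
    (fun u _ => HasDerivAt.hasDerivWithinAt ?_)
    (fun u hu => ?_) (x := 0) (y := p) (by simp) ⟨neg_abs_le p, le_abs_self p⟩
  · simp only [mul_zero, freq_zero hμ, Real.norm_eq_abs, sub_zero] at h
    have h2 : |Real.arctan (m * ε) / ε - m| ≤ m ^ 3 * ε ^ 2 := by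
      have h3 := abs_arctan_sub_le (m * ε)
      rw [abs_of_pos hμ] at h3
      rw [show Real.arctan (m * ε) / ε - m = (Real.arctan (m * ε) - m * ε) / ε by field_simp,
        abs_div, abs_of_pos hε, div_le_iff₀ hε]
      calc _ ≤ _ := h3
        _ = _ := by ring
    calc _ = |(freq (m * ε) (ε * p) / ε - p ^ 2 / (2 * m) -
          (Real.arctan (m * ε) / ε - 0 ^ 2 / (2 * m))) + (Real.arctan (m * ε) / ε - m)| := by
          congr 1; ring
      _ ≤ _ := abs_add_le _ _
      _ ≤ (1 / m + 1 / m ^ 3) * |p| ^ 3 * |p| + m ^ 3 * ε ^ 2 := add_le_add h h2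
      _ = _ := by ring
  · have h1 : HasDerivAt (fun u => freq (m * ε) (ε * u)) _ u :=
      (hasDerivAt_freq hμ (ε * u)).comp u ((hasDerivAt_id u).const_mul ε)
    refine ((h1.div_const ε).sub ((hasDerivAt_pow 2 u).div_const (2 * m))).congr_deriv ?_
    field_simp
    push_cast
    ring
  · have hu' : |u| ≤ |p| := abs_le.2 hu
    refine (abs_velocity_sub_le hm hε hε1 u).trans ?_
    gcongr

/-! ### Lattice waves away from the stationary point -/

/-- The amplitude of the lattice wave of positive (`s = 1`) or negative (`s = -1`) frequency. -/
noncomputable def amplitude (μ s θ : ℝ) : ℂ :=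
  Complex.exp (θ * Complex.I) * (1 + s * Real.sin (velocityAngle μ θ) : ℝ) -
    (s * Real.cos (velocityAngle μ θ) : ℝ)

/-- The contribution of the lattice wave of positive or negative frequency, restricted to an
interval of wave numbers. -/
noncomputable def waveIntegral (μ s N Y a b : ℝ) : ℂ :=
  ∫ θ in a..b, amplitude μ s θ * Complex.exp (s * Complex.I * (N * freq μ θ + Y * θ : ℝ))

theorem continuous_velocityAngle (hμ : 0 < μ) : Continuous (velocityAngle μ) :=
  continuous_iff_continuousAt.2 fun θ => (hasDerivAt_velocityAngle hμ θ).continuousAt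

theorem continuous_freq (μ : ℝ) : Continuous (freq μ) := by
  unfold freq
  fun_prop

theorem continuous_amplitude (hμ : 0 < μ) (s : ℝ) : Continuous (amplitude μ s) := by
  have := continuous_velocityAngle hμ
  unfold amplitude
  fun_prop

theorem norm_amplitude_le {s : ℝ} (hs : |s| = 1) (θ : ℝ) : ‖amplitude μ s θ‖ ≤ 3 := by
  have h1 := Real.abs_sin_le_one (velocityAngle μ θ)
  have h2 := Real.abs_cos_le_one (velocityAngle μ θ)
  refine (norm_sub_le _ _).trans ?_
  rw [norm_mul, Complex.norm_exp_ofReal_mul_I, one_mul, Complex.norm_real, Complex.norm_real,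
    Real.norm_eq_abs, Real.norm_eq_abs]
  have h3 : |1 + s * Real.sin (velocityAngle μ θ)| ≤ |1| + |s * Real.sin (velocityAngle μ θ)| :=
    abs_add_le _ _
  rw [abs_mul, hs, one_mul, abs_one] at h3
  rw [abs_mul, hs, one_mul]
  linarith

/-- The derivative of the amplitude. -/
noncomputable def amplitudeDeriv (μ s θ : ℝ) : ℂ :=
  Complex.exp (θ * Complex.I) * Complex.I * (1 + s * Real.sin (velocityAngle μ θ) : ℝ) +
    (s * (μ * Real.cos θ / energy μ θ ^ 2) : ℝ) * (Complex.exp (θ * Complex.I) *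
      Real.cos (velocityAngle μ θ) + Real.sin (velocityAngle μ θ))

theorem hasDerivAt_amplitude (hμ : 0 < μ) (s θ : ℝ) :
    HasDerivAt (amplitude μ s) (amplitudeDeriv μ s θ) θ := by
  have hΘ := hasDerivAt_velocityAngle hμ θ
  have h1 : HasDerivAt (fun θ : ℝ => Complex.exp (θ * Complex.I)) _ θ :=
    (((hasDerivAt_id θ).ofReal_comp).mul_const Complex.I).cexp
  have h2 := (((hΘ.sin).const_mul s).const_add 1).ofReal_comp
  have h3 := ((hΘ.cos).const_mul s).ofReal_comp
  refine ((h1.mul h2).sub h3).congr_deriv ?_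
  simp only [amplitudeDeriv, id]
  push_cast
  ring

theorem continuous_velocityAngleDeriv (hμ : 0 < μ) :
    Continuous fun θ => μ * Real.cos θ / energy μ θ ^ 2 :=
  (by fun_prop : Continuous fun θ => μ * Real.cos θ).div ((continuous_energy μ).pow 2)
    fun θ => pow_ne_zero 2 (energy_pos hμ θ).ne'

theorem continuous_amplitudeDeriv (hμ : 0 < μ) (s : ℝ) : Continuous (amplitudeDeriv μ s) := by
  have h1 := continuous_velocityAngle hμ
  have h2 := continuous_velocityAngleDeriv hμ
  unfold amplitudeDeriv
  refine Continuous.add (by fun_prop) (Continuous.mul ?_ (by fun_prop))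
  exact Complex.continuous_ofReal.comp (continuous_const.mul h2)

/-- The second term is twice the derivative of `velocityAngle`. It can be as large as `2/μ`, but its
integral is at most `2π`, so the variation of the amplitude is bounded uniformly in `μ`. -/
theorem norm_amplitudeDeriv_le (hμ : 0 < μ) {s : ℝ} (hs : |s| = 1) {θ : ℝ}
    (hθ : θ ∈ Set.Icc (-(Real.pi / 2)) (Real.pi / 2)) :
    ‖amplitudeDeriv μ s θ‖ ≤ 2 + 2 * (μ * Real.cos θ / energy μ θ ^ 2) := by
  have hc := Real.cos_nonneg_of_mem_Icc hθ
  have hE := energy_pos hμ θ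
  have h1 := Real.abs_sin_le_one (velocityAngle μ θ)
  have h2 := Real.abs_cos_le_one (velocityAngle μ θ)
  have h3 : |1 + s * Real.sin (velocityAngle μ θ)| ≤ |1| + |s * Real.sin (velocityAngle μ θ)| :=
    abs_add_le _ _
  rw [abs_mul, hs, one_mul, abs_one] at h3
  refine (norm_add_le _ _).trans (add_le_add ?_ ?_)
  · rw [norm_mul, norm_mul, Complex.norm_exp_ofReal_mul_I, Complex.norm_I, Complex.norm_real,
      Real.norm_eq_abs]
    linarith
  · rw [norm_mul, Complex.norm_real, Real.norm_eq_abs, abs_mul, hs, one_mul,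
      abs_of_nonneg (by positivity), mul_comm]
    gcongr
    refine (norm_add_le _ _).trans ?_
    rw [norm_mul, Complex.norm_exp_ofReal_mul_I, Complex.norm_real, Complex.norm_real,
      Real.norm_eq_abs, Real.norm_eq_abs]
    linarith

theorem norm_waveIntegral_le (hμ : 0 < μ) {s : ℝ} (hs : |s| = 1) {N Y a b l : ℝ} (hN : 0 ≤ N)
    (ha : -(Real.pi / 2) ≤ a) (hab : a ≤ b) (hb : b ≤ Real.pi / 2) (hl : 0 < l)
    (h : l ≤ N * velocity μ a + Y ∨ N * velocity μ b + Y ≤ -l) :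
    ‖waveIntegral μ s N Y a b‖ ≤ (12 + 4 * Real.pi) / l := by
  have hsub : Set.Icc a b ⊆ Set.Icc (-(Real.pi / 2)) (Real.pi / 2) := Set.Icc_subset_Icc ha hb
  have hs0 : (s : ℂ) * Complex.I ≠ 0 := by
    have : s ≠ 0 := fun h => by simp [h] at hs
    simp [this]
  have hnorm : ‖(s : ℂ) * Complex.I‖ = 1 := by simp [hs]
  have cφ'' : Continuous fun θ => N * (μ ^ 2 * Real.cos θ / energy μ θ ^ 3) :=
    continuous_const.mul ((by fun_prop : Continuous fun θ => μ ^ 2 * Real.cos θ).div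
      ((continuous_energy μ).pow 3) fun θ => pow_ne_zero 3 (energy_pos hμ θ).ne')
  -- Both `θ` and `velocityAngle` range over an interval of length at most `π`, so `V` grows by at
  -- most `4π`; no constant depends on `μ`.
  have key := norm_integral_mul_exp_le (a := a) (b := b) hab hs0 (l := l) (M := 3)
    (W := 4 * Real.pi) (φ := fun θ => N * freq μ θ + Y * θ)
    (φ' := fun θ => N * velocity μ θ + Y)
    (φ'' := fun θ => N * (μ ^ 2 * Real.cos θ / energy μ θ ^ 3))
    (V := fun θ => 2 * θ + 2 * velocityAngle μ θ)
    (V' := fun θ => 2 + 2 * (μ * Real.cos θ / energy μ θ ^ 2)) hl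
    (fun θ => (((hasDerivAt_freq hμ θ).const_mul N).add
      ((hasDerivAt_id θ).const_mul Y)).congr_deriv (by simp))
    (fun θ => ((hasDerivAt_velocity hμ θ).const_mul N).add_const Y)
    (hasDerivAt_amplitude hμ s)
    (fun θ => (((hasDerivAt_id θ).const_mul 2).add
      ((hasDerivAt_velocityAngle hμ θ).const_mul 2)).congr_deriv (by simp))
    cφ'' (continuous_amplitudeDeriv hμ s)
    (continuous_const.add (continuous_const.mul (continuous_velocityAngleDeriv hμ)))
    (fun θ hθ => ?_) (fun θ hθ => ?_) (fun θ hθ => ?_) (fun θ _ => norm_amplitude_le hs θ)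
    (fun θ hθ => norm_amplitudeDeriv_le hμ hs (hsub hθ)) ?_
  · rw [hnorm, mul_one] at key
    refine key.trans (le_of_eq ?_)
    norm_num
  · have := Real.cos_nonneg_of_mem_Icc (hsub hθ)
    have := energy_pos hμ θ
    positivity
  · rcases h with h | h
    · have h1 := monotoneOn_velocity hμ (hsub (Set.left_mem_Icc.2 hab)) (hsub hθ) hθ.1
      have h2 := mul_le_mul_of_nonneg_left h1 hN
      exact (by linarith : l ≤ N * velocity μ θ + Y).trans (le_abs_self _)
    · have h1 := monotoneOn_velocity hμ (hsub hθ) (hsub (Set.right_mem_Icc.2 hab)) hθ.2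
      have h2 := mul_le_mul_of_nonneg_left h1 hN
      exact (by linarith : l ≤ -(N * velocity μ θ + Y)).trans (neg_le_abs _)
  · rw [Complex.norm_exp]
    simp
  · have h1 := Real.arctan_lt_pi_div_two (Real.sin b / μ)
    have h2 := Real.neg_pi_div_two_lt_arctan (Real.sin a / μ)
    simp only [velocityAngle]
    linarith

theorem intervalIntegrable_wave (hμ : 0 < μ) (s N Y a b : ℝ) :
    IntervalIntegrable (fun θ : ℝ => amplitude μ s θ *
      Complex.exp (s * Complex.I * (N * freq μ θ + Y * θ : ℝ))) MeasureTheory.volume a b := by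
  have := continuous_freq μ
  have := continuous_amplitude hμ s
  exact Continuous.intervalIntegrable (by fun_prop) a b

theorem norm_waveIntegral_sub_le (hμ : 0 < μ) {s : ℝ} (hs : |s| = 1) {N Y a b l : ℝ} (hN : 0 ≤ N)
    (ha : a ∈ Set.Icc (-(Real.pi / 2)) (Real.pi / 2))
    (hb : b ∈ Set.Icc (-(Real.pi / 2)) (Real.pi / 2)) (hl : 0 < l)
    (hla : N * velocity μ a + Y ≤ -l) (hlb : l ≤ N * velocity μ b + Y) :
    ‖waveIntegral μ s N Y (-(Real.pi / 2)) (Real.pi / 2) - waveIntegral μ s N Y a b‖ ≤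
      2 * ((12 + 4 * Real.pi) / l) := by
  have hi := intervalIntegrable_wave hμ s N Y
  have h : waveIntegral μ s N Y (-(Real.pi / 2)) (Real.pi / 2) - waveIntegral μ s N Y a b =
      waveIntegral μ s N Y (-(Real.pi / 2)) a + waveIntegral μ s N Y b (Real.pi / 2) := by
    simp only [waveIntegral]
    rw [← intervalIntegral.integral_add_adjacent_intervals (hi _ a) (hi _ _),
      ← intervalIntegral.integral_add_adjacent_intervals (hi a b) (hi _ _)]
    ring
  rw [h, two_mul]
  exact (norm_add_le _ _).trans (add_le_add
    (norm_waveIntegral_le hμ hs hN le_rfl ha.1 ha.2 hl (Or.inr hla))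
    (norm_waveIntegral_le hμ hs hN hb.1 hb.2 le_rfl hl (Or.inl hlb)))

/-! ### Stationary phase in a shrinking window -/

/-- The wave number at the rescaled distance `u` from the stationary point, at time `τ ^ 4`. -/
noncomputable def windowPoint (m y τ u : ℝ) : ℝ := -(m * y / τ ^ 4) + u / τ ^ 2

theorem norm_exp_mul_I_mul (s v : ℝ) : ‖Complex.exp (s * Complex.I * v)‖ = 1 := by
  rw [Complex.norm_exp]
  simp

section Window

variable {m : ℝ} {ε τ y N : ℕ → ℝ}

theorem tendsto_inv_of_atTop (hτ : Tendsto τ atTop atTop) :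
    Tendsto (fun k => (τ k)⁻¹) atTop (𝓝 0) :=
  tendsto_inv_atTop_zero.comp hτ

/-- With `τ = t^(1/4)`, this says that `tp⁴ → 0`, which is what discards the quartic term of the
dispersion relation. -/
theorem tendsto_mul_windowPoint (m : ℝ) (hτ0 : ∀ k, 0 < τ k) (hτ : Tendsto τ atTop atTop)
    (hy : Tendsto (fun k => y k / τ k ^ 3) atTop (𝓝 0)) (u : ℝ) :
    Tendsto (fun k => τ k * windowPoint m (y k) (τ k) u) atTop (𝓝 0) := by
  have h : Tendsto (fun k => -(m * (y k / τ k ^ 3)) + u * (τ k)⁻¹) atTop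
      (𝓝 (-(m * 0) + u * 0)) :=
    ((hy.const_mul m).neg).add ((tendsto_inv_of_atTop hτ).const_mul u)
  simp only [mul_zero, neg_zero, add_zero] at h
  refine h.congr fun k => ?_
  have := (hτ0 k).ne'
  simp only [windowPoint]
  field_simp

theorem tendsto_windowPoint (m : ℝ) (hτ0 : ∀ k, 0 < τ k) (hτ : Tendsto τ atTop atTop)
    (hy : Tendsto (fun k => y k / τ k ^ 3) atTop (𝓝 0)) (u : ℝ) :
    Tendsto (fun k => windowPoint m (y k) (τ k) u) atTop (𝓝 0) := by
  have h := (tendsto_inv_of_atTop hτ).mul (tendsto_mul_windowPoint m hτ0 hτ hy u)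
  rw [zero_mul] at h
  refine h.congr fun k => ?_
  rw [inv_mul_cancel_left₀ (hτ0 k).ne']

theorem tendsto_step_size (hτ0 : ∀ k, 0 < τ k) (hτ : Tendsto τ atTop atTop)
    (hε : Tendsto (fun k => ε k * τ k ^ 2) atTop (𝓝 0)) : Tendsto ε atTop (𝓝 0) := by
  have h := hε.mul ((tendsto_inv_of_atTop hτ).pow 2)
  rw [zero_mul] at h
  refine h.congr fun k => ?_
  have := (hτ0 k).ne'
  field_simp

theorem tendsto_phase (hm : 0 < m) (hε0 : ∀ k, 0 < ε k) (hτ0 : ∀ k, 0 < τ k)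
    (hτ : Tendsto τ atTop atTop) (hy : Tendsto (fun k => y k / τ k ^ 3) atTop (𝓝 0))
    (hε : Tendsto (fun k => ε k * τ k ^ 2) atTop (𝓝 0))
    (hN : ∀ k, N k * ε k + ε k = τ k ^ 4) (u : ℝ) :
    Tendsto (fun k => N k * freq (m * ε k) (ε k * windowPoint m (y k) (τ k) u) +
      y k / ε k * (ε k * windowPoint m (y k) (τ k) u) -
      (m * τ k ^ 4 - m * y k ^ 2 / (2 * τ k ^ 4))) atTop (𝓝 (u ^ 2 / (2 * m))) := by
  set p : ℕ → ℝ := fun k => windowPoint m (y k) (τ k) u with hp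
  have hε' := tendsto_step_size hτ0 hτ hε
  have hp0 : Tendsto p atTop (𝓝 0) := tendsto_windowPoint m hτ0 hτ hy u
  have hτp : Tendsto (fun k => τ k * p k) atTop (𝓝 0) := tendsto_mul_windowPoint m hτ0 hτ hy u
  set e : ℕ → ℝ := fun k => freq (m * ε k) (ε k * p k) / ε k - (m + p k ^ 2 / (2 * m)) with he
  have hbound : Tendsto (fun k => (1 / m + 1 / m ^ 3) * |τ k * p k| ^ 4 +
      m ^ 3 * (ε k * τ k ^ 2) ^ 2) atTop (𝓝 0) := by
    have := ((hτp.abs.pow 4).const_mul (1 / m + 1 / m ^ 3)).add ((hε.pow 2).const_mul (m ^ 3))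
    simpa using this
  have hτe : Tendsto (fun k => τ k ^ 4 * e k) atTop (𝓝 0) := by
    refine squeeze_zero_norm' ?_ hbound
    filter_upwards [hε'.eventually_le_const zero_lt_one] with k hk
    have h := abs_freq_sub_le hm (hε0 k) hk (p k)
    have h4 : 0 < τ k ^ 4 := pow_pos (hτ0 k) 4
    rw [Real.norm_eq_abs, abs_mul, abs_of_pos h4, abs_mul, abs_of_pos (hτ0 k)]
    calc _ ≤ τ k ^ 4 * ((1 / m + 1 / m ^ 3) * |p k| ^ 4 + m ^ 3 * ε k ^ 2) := by gcongr
      _ = _ := by ring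
  have he0 : Tendsto e atTop (𝓝 0) := by
    have h := ((tendsto_inv_of_atTop hτ).pow 4).mul hτe
    rw [mul_zero] at h
    refine h.congr fun k => ?_
    have := (hτ0 k).ne'
    field_simp
  -- Since `Nε = τ⁴ - ε`, the phase falls short of the full time by one frequency, which tends to
  -- zero.
  have hw : Tendsto (fun k => ε k * (e k + (m + p k ^ 2 / (2 * m)))) atTop (𝓝 0) := by
    have := hε'.mul (he0.add (((hp0.pow 2).div_const (2 * m)).const_add m))
    simpa using this
  have hmain := (hτe.sub hw).add_const (u ^ 2 / (2 * m))
  rw [sub_zero, zero_add] at hmain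
  refine hmain.congr fun k => ?_
  have h1 := (hτ0 k).ne'
  have h2 := (hε0 k).ne'
  have h3 : N k = (τ k ^ 4 - ε k) / ε k := by
    rw [eq_div_iff h2]
    linarith [hN k]
  -- Completing the square; `windowPoint` is chosen for this identity.
  have h4 : τ k ^ 4 * (p k ^ 2 / (2 * m)) + y k * p k =
      u ^ 2 / (2 * m) - m * y k ^ 2 / (2 * τ k ^ 4) := by
    simp only [hp, windowPoint]
    field_simp
    ring
  have h5 : y k / ε k * (ε k * p k) = y k * p k := by field_simp
  rw [h5, h3, he]
  have h6 : (τ k ^ 4 - ε k) / ε k * freq (m * ε k) (ε k * p k) =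
    (τ k ^ 4 - ε k) * (freq (m * ε k) (ε k * p k) / ε k) := by ring
  simp only
  rw [h6]
  linear_combination -h4

/-- At the window edges `u = ±K` this provides the slope that the first derivative test needs. -/
theorem tendsto_phaseDeriv (hm : 0 < m) (hε0 : ∀ k, 0 < ε k) (hτ0 : ∀ k, 0 < τ k)
    (hτ : Tendsto τ atTop atTop) (hy : Tendsto (fun k => y k / τ k ^ 3) atTop (𝓝 0))
    (hε : Tendsto (fun k => ε k * τ k ^ 2) atTop (𝓝 0))
    (hN : ∀ k, N k * ε k + ε k = τ k ^ 4) (u : ℝ) :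
    Tendsto (fun k => ε k / τ k ^ 2 *
      (N k * velocity (m * ε k) (ε k * windowPoint m (y k) (τ k) u) + y k / ε k))
      atTop (𝓝 (u / m)) := by
  set p : ℕ → ℝ := fun k => windowPoint m (y k) (τ k) u with hp
  have hε' := tendsto_step_size hτ0 hτ hε
  have hp0 : Tendsto p atTop (𝓝 0) := tendsto_windowPoint m hτ0 hτ hy u
  have hτp : Tendsto (fun k => τ k * p k) atTop (𝓝 0) := tendsto_mul_windowPoint m hτ0 hτ hy u
  have hbound : Tendsto (fun k => (1 / m + 1 / m ^ 3) * (|τ k * p k| ^ 2 * |p k|)) atTop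
      (𝓝 0) := by
    have := ((hτp.abs.pow 2).mul hp0.abs).const_mul (1 / m + 1 / m ^ 3)
    simpa using this
  have h1 : Tendsto (fun k => τ k ^ 2 * (velocity (m * ε k) (ε k * p k) - p k / m)) atTop
      (𝓝 0) := by
    refine squeeze_zero_norm' ?_ hbound
    filter_upwards [hε'.eventually_le_const zero_lt_one] with k hk
    have h := abs_velocity_sub_le hm (hε0 k) hk (p k)
    have h4 : 0 < τ k ^ 2 := pow_pos (hτ0 k) 2
    rw [Real.norm_eq_abs, abs_mul, abs_of_pos h4, abs_mul, abs_of_pos (hτ0 k)]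
    calc _ ≤ τ k ^ 2 * ((1 / m + 1 / m ^ 3) * |p k| ^ 3) := by gcongr
      _ = _ := by ring
  have hbound2 : Tendsto (fun k => ε k * ((τ k)⁻¹) ^ 2) atTop (𝓝 0) := by
    simpa using hε'.mul ((tendsto_inv_of_atTop hτ).pow 2)
  have h2 : Tendsto (fun k => ε k / τ k ^ 2 * velocity (m * ε k) (ε k * p k)) atTop (𝓝 0) := by
    refine squeeze_zero_norm (fun k => ?_) hbound2
    have := hτ0 k
    have := hε0 k
    rw [Real.norm_eq_abs, abs_mul, abs_of_pos (by positivity), inv_pow, ← div_eq_mul_inv]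
    exact mul_le_of_le_one_right (by positivity) (abs_velocity_le (mul_pos hm (hε0 k)) _)
  have hmain := (h1.sub h2).add_const (u / m)
  rw [sub_zero, zero_add] at hmain
  refine hmain.congr fun k => ?_
  have h1 := (hτ0 k).ne'
  have h2 := (hε0 k).ne'
  have h3 : N k = (τ k ^ 4 - ε k) / ε k := by
    rw [eq_div_iff h2]
    linarith [hN k]
  have h4 : y k / τ k ^ 2 = u / m - τ k ^ 2 * (p k / m) := by
    simp only [hp, windowPoint]
    field_simp
    ring
  rw [h3]
  have h5 : ∀ v : ℝ, ε k / τ k ^ 2 * ((τ k ^ 4 - ε k) / ε k * v + y k / ε k) =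
      τ k ^ 2 * v - ε k / τ k ^ 2 * v + y k / τ k ^ 2 := fun v => by
    field_simp
  rw [h5, h4]
  ring

/-- The ratio `sin(εp)/(mε)` is at most `|p|/m` in absolute value, so the velocity angle tends to
zero although `μ` does as well. -/
theorem tendsto_amplitude (hm : 0 < m) (s : ℝ) (hε0 : ∀ k, 0 < ε k) (hε : Tendsto ε atTop (𝓝 0))
    {p : ℕ → ℝ} (hp : Tendsto p atTop (𝓝 0)) :
    Tendsto (fun k => amplitude (m * ε k) s (ε k * p k)) atTop (𝓝 (1 - s)) := by
  have h1 : Tendsto (fun k => Real.sin (ε k * p k) / (m * ε k)) atTop (𝓝 0) := by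
    have hb : Tendsto (fun k => |p k| / m) atTop (𝓝 0) := by
      simpa using hp.abs.div_const m
    refine squeeze_zero_norm (fun k => ?_) hb
    have h := Real.abs_sin_le_abs (x := ε k * p k)
    have hk := hε0 k
    rw [abs_mul, abs_of_pos hk] at h
    rw [Real.norm_eq_abs, abs_div, abs_of_pos (mul_pos hm hk), div_le_div_iff₀
      (mul_pos hm hk) hm]
    nlinarith
  have h2 : Tendsto (fun k => velocityAngle (m * ε k) (ε k * p k)) atTop (𝓝 0) := by
    have := (Real.continuous_arctan.tendsto 0).comp h1
    rwa [Real.arctan_zero] at this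
  have h3 : Tendsto (fun k => ε k * p k) atTop (𝓝 0) := by simpa using hε.mul hp
  have hc : Continuous fun q : ℝ × ℝ => Complex.exp (q.1 * Complex.I) *
      (1 + s * Real.sin q.2 : ℝ) - (s * Real.cos q.2 : ℝ) := by fun_prop
  have h4 := (hc.tendsto (0, 0)).comp (h3.prodMk_nhds h2)
  simpa [amplitude, Function.comp_def] using h4

/-- The normalized contribution of a window around the stationary point. -/
theorem tendsto_window (hm : 0 < m) {s : ℝ} (hs : |s| = 1) (hε0 : ∀ k, 0 < ε k)
    (hτ0 : ∀ k, 0 < τ k) (hτ : Tendsto τ atTop atTop)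
    (hy : Tendsto (fun k => y k / τ k ^ 3) atTop (𝓝 0))
    (hε : Tendsto (fun k => ε k * τ k ^ 2) atTop (𝓝 0))
    (hN : ∀ k, N k * ε k + ε k = τ k ^ 4) (K : ℝ) :
    Tendsto (fun k => (τ k ^ 2 / ε k : ℝ) *
      Complex.exp (-(s * Complex.I * (m * τ k ^ 4 - m * y k ^ 2 / (2 * τ k ^ 4) : ℝ))) *
      waveIntegral (m * ε k) s (N k) (y k / ε k) (ε k * windowPoint m (y k) (τ k) (-K))
        (ε k * windowPoint m (y k) (τ k) K)) atTop
      (𝓝 ((1 - s) * ∫ u in (-K)..K, Complex.exp (-(((-s / (2 * m) : ℝ) : ℂ) * Complex.I) *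
        (u : ℂ) ^ 2))) := by
  set f : ℕ → ℝ → ℂ := fun k u => amplitude (m * ε k) s (ε k * windowPoint m (y k) (τ k) u) *
    Complex.exp (s * Complex.I * (N k * freq (m * ε k) (ε k * windowPoint m (y k) (τ k) u) +
      y k / ε k * (ε k * windowPoint m (y k) (τ k) u) -
      (m * τ k ^ 4 - m * y k ^ 2 / (2 * τ k ^ 4)) : ℝ)) with hf
  have hscale : ∀ k, (τ k ^ 2 / ε k : ℝ) *
      Complex.exp (-(s * Complex.I * (m * τ k ^ 4 - m * y k ^ 2 / (2 * τ k ^ 4) : ℝ))) *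
      waveIntegral (m * ε k) s (N k) (y k / ε k) (ε k * windowPoint m (y k) (τ k) (-K))
        (ε k * windowPoint m (y k) (τ k) K) = ∫ u in (-K)..K, f k u := by
    intro k
    have h1 := (hτ0 k).ne'
    have h2 := (hε0 k).ne'
    have hlin : ∀ u, ε k * windowPoint m (y k) (τ k) u =
        ε k / τ k ^ 2 * u + -(ε k * (m * y k / τ k ^ 4)) := fun u => by
      simp only [windowPoint]
      ring
    -- The affine substitution from `θ` to `u`; its Jacobian `ε/τ²` cancels the normalizing factor.
    have hsub := intervalIntegral.smul_integral_comp_mul_add (a := -K) (b := K)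
      (fun θ : ℝ => amplitude (m * ε k) s θ * Complex.exp (s * Complex.I *
        (N k * freq (m * ε k) θ + y k / ε k * θ : ℝ))) (ε k / τ k ^ 2)
      (-(ε k * (m * y k / τ k ^ 4)))
    simp only [← hlin] at hsub
    have hone : ((τ k ^ 2 / ε k : ℝ) : ℂ) * ((ε k / τ k ^ 2 : ℝ) : ℂ) = 1 := by
      rw [← Complex.ofReal_mul, ← Complex.ofReal_one]
      congr 1
      field_simp
    rw [waveIntegral, ← hsub, Complex.real_smul]
    simp only [hf]
    rw [mul_mul_mul_comm, hone, one_mul, ← intervalIntegral.integral_const_mul]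
    congr 1
    ext u
    rw [mul_left_comm, ← Complex.exp_add]
    congr 2
    push_cast
    ring
  simp only [hscale]
  rw [← intervalIntegral.integral_const_mul]
  refine intervalIntegral.tendsto_integral_filter_of_dominated_convergence (fun _ => 3)
    (Eventually.of_forall fun k => ?_) (Eventually.of_forall fun k => ?_)
    intervalIntegrable_const ?_
  · have h1 := continuous_freq (m * ε k)
    have h2 := continuous_amplitude (mul_pos hm (hε0 k)) s
    refine Continuous.aestronglyMeasurable ?_
    simp only [hf, windowPoint]
    fun_prop
  · refine Eventually.of_forall fun u _ => ?_
    simp only [hf]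
    rw [norm_mul, norm_exp_mul_I_mul, mul_one]
    exact norm_amplitude_le hs _
  · refine Eventually.of_forall fun u _ => ?_
    have h1 := tendsto_amplitude hm s hε0 (tendsto_step_size hτ0 hτ hε)
      (tendsto_windowPoint m hτ0 hτ hy u)
    have h2 := tendsto_phase hm hε0 hτ0 hτ hy hε hN u
    have hc : Continuous fun v : ℝ => Complex.exp (s * Complex.I * v) := by fun_prop
    have h3 := h1.mul ((hc.tendsto _).comp h2)
    have hval : Complex.exp (-(((-s / (2 * m) : ℝ) : ℂ) * Complex.I) * (u : ℂ) ^ 2) =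
        Complex.exp (s * Complex.I * (u ^ 2 / (2 * m) : ℝ)) := by
      push_cast
      ring_nf
    rw [hval]
    exact h3

theorem tendsto_waveIntegral (hm : 0 < m) {s : ℝ} (hs : |s| = 1) (hε0 : ∀ k, 0 < ε k)
    (hτ0 : ∀ k, 0 < τ k) (hτ : Tendsto τ atTop atTop)
    (hy : Tendsto (fun k => y k / τ k ^ 3) atTop (𝓝 0))
    (hε : Tendsto (fun k => ε k * τ k ^ 2) atTop (𝓝 0)) (hN0 : ∀ k, 0 ≤ N k)
    (hN : ∀ k, N k * ε k + ε k = τ k ^ 4) :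
    Tendsto (fun k => (τ k ^ 2 / ε k : ℝ) *
      Complex.exp (-(s * Complex.I * (m * τ k ^ 4 - m * y k ^ 2 / (2 * τ k ^ 4) : ℝ))) *
      waveIntegral (m * ε k) s (N k) (y k / ε k) (-(Real.pi / 2)) (Real.pi / 2)) atTop
      (𝓝 ((1 - s) * (Real.pi / (((-s / (2 * m) : ℝ) : ℂ) * Complex.I)) ^ (1 / 2 : ℂ))) := by
  have hs0 : s ≠ 0 := fun h => by simp [h] at hs
  have hpi := Real.pi_pos
  have hr : -s / (2 * m) ≠ 0 := by
    simp [hs0, hm.ne']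
  have hrabs : |-s / (2 * m)| = 1 / (2 * m) := by
    rw [abs_div, abs_neg, hs, abs_of_pos (by positivity)]
  have hs1 : ‖(1 - s : ℂ)‖ ≤ 2 := by
    refine (norm_sub_le _ _).trans ?_
    rw [norm_one, Complex.norm_real, Real.norm_eq_abs, hs]
    norm_num
  set L : ℂ := (Real.pi / (((-s / (2 * m) : ℝ) : ℂ) * Complex.I)) ^ (1 / 2 : ℂ)
  -- The first summand collects the two tails outside the window, the second the truncation of the
  -- Fresnel integral; both errors have the form constant over `K`.
  set D : ℝ := 4 * (12 + 4 * Real.pi) * m + 16 * m with hD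
  have hD0 : 0 < D := by positivity
  rw [Metric.tendsto_nhds]
  intro η hη
  obtain ⟨K, hK0, hKη⟩ : ∃ K : ℝ, 0 < K ∧ D / K < η / 2 := by
    refine ⟨4 * D / η, by positivity, ?_⟩
    field_simp
    linarith
  have hε' := tendsto_step_size hτ0 hτ hε
  have hwin := Metric.tendsto_nhds.1 (tendsto_window hm hs hε0 hτ0 hτ hy hε hN K) (η / 2)
    (by positivity)
  have hedge : ∀ u, ∀ᶠ k in atTop, ε k * windowPoint m (y k) (τ k) u ∈
      Set.Icc (-(Real.pi / 2)) (Real.pi / 2) := fun u => by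
    have h := hε'.mul (tendsto_windowPoint m hτ0 hτ hy u)
    rw [zero_mul] at h
    exact h.eventually (Icc_mem_nhds (by linarith) (by linarith))
  have hright := (tendsto_phaseDeriv hm hε0 hτ0 hτ hy hε hN K).eventually_const_lt
    (show K / (2 * m) < K / m by
      rw [div_lt_div_iff₀ (by positivity) hm]
      nlinarith [mul_pos hK0 hm])
  have hleft := (tendsto_phaseDeriv hm hε0 hτ0 hτ hy hε hN (-K)).eventually_lt_const
    (show -K / m < -(K / (2 * m)) by
      rw [← neg_div, div_lt_div_iff₀ hm (by positivity)]
      nlinarith [mul_pos hK0 hm])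
  filter_upwards [hwin, hedge K, hedge (-K), hright, hleft] with k h1 h2 h3 h4 h5
  have hτk := hτ0 k
  have hεk := hε0 k
  have hq : 0 < ε k / τ k ^ 2 := by positivity
  -- Half of the limiting slope `K/m` at the edges, in the original variable `θ`.
  set l : ℝ := K / (2 * m) * (τ k ^ 2 / ε k) with hl
  have hl0 : 0 < l := by positivity
  have hinv : ∀ v, v = ε k / τ k ^ 2 * v * (τ k ^ 2 / ε k) := fun v => by field_simp
  have htail := norm_waveIntegral_sub_le (mul_pos hm hεk) hs (hN0 k) h3 h2 hl0
    (Y := y k / ε k) (by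
      rw [hinv (_ + _), hl, ← neg_mul]
      exact mul_le_mul_of_nonneg_right h5.le (by positivity)) (by
      rw [hinv (_ + _), hl]
      exact mul_le_mul_of_nonneg_right h4.le (by positivity))
  have hfres := norm_integral_fresnel_sub_le hr hK0
  rw [hrabs] at hfres
  rw [dist_eq_norm] at h1 ⊢
  set c : ℂ := (τ k ^ 2 / ε k : ℝ) *
      Complex.exp (-(s * Complex.I * (m * τ k ^ 4 - m * y k ^ 2 / (2 * τ k ^ 4) : ℝ))) with hc
  have hcn : ‖c‖ = τ k ^ 2 / ε k := by
    rw [hc, norm_mul, Complex.exp_neg, norm_inv, norm_exp_mul_I_mul, Complex.norm_real,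
      Real.norm_eq_abs, abs_of_pos (by positivity), inv_one, mul_one]
  set w := waveIntegral (m * ε k) s (N k) (y k / ε k) (-(Real.pi / 2)) (Real.pi / 2)
  set w' := waveIntegral (m * ε k) s (N k) (y k / ε k) (ε k * windowPoint m (y k) (τ k) (-K))
        (ε k * windowPoint m (y k) (τ k) K)
  set J := ∫ u in (-K)..K, Complex.exp (-(((-s / (2 * m) : ℝ) : ℂ) * Complex.I) * (u : ℂ) ^ 2)
  have hA : ‖c * (w - w')‖ ≤ 4 * (12 + 4 * Real.pi) * m / K := by
    rw [norm_mul, hcn]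
    calc _ ≤ τ k ^ 2 / ε k * (2 * ((12 + 4 * Real.pi) / l)) := by gcongr
      _ = _ := by
        rw [hl]
        field_simp
        norm_num
  have hB : ‖(1 - s : ℂ) * (J - L)‖ ≤ 16 * m / K := by
    rw [norm_mul]
    calc _ ≤ 2 * (4 / (1 / (2 * m) * K)) := by gcongr
      _ = _ := by
        field_simp
        norm_num
  calc ‖c * w - (1 - s) * L‖ = ‖c * (w - w') + (c * w' - (1 - s) * J) + (1 - s) * (J - L)‖ := by
        congr 1; ring
    _ ≤ ‖c * (w - w')‖ + ‖c * w' - (1 - s) * J‖ + ‖(1 - s) * (J - L)‖ := norm_add₃_le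
    _ < 4 * (12 + 4 * Real.pi) * m / K + η / 2 + 16 * m / K := by linarith
    _ = D / K + η / 2 := by rw [hD]; ring
    _ < η := by linarith

end Window

/-! ### The kernel as a sum of two waves -/

theorem exists_steps {x t ε : ℝ} (hε : 0 < ε) (ht : 0 < t) (hl : (x, t) ∈ lattice ε)
    (he : ∃ j : ℤ, Even j ∧ (x + t) / ε = j) :
    ∃ (n : ℕ) (K : ℤ), Even (K + n) ∧ x = (K + 1) * ε ∧ t = (n + 1) * ε := by
  obtain ⟨⟨k, hk⟩, l, hl⟩ := hl
  obtain ⟨j, hj, hjx⟩ := he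
  simp only at hk hl
  have hl0 : 0 < l := by
    have : (0 : ℝ) < l := hl ▸ div_pos ht hε
    exact_mod_cast this
  obtain ⟨n, hn⟩ := Int.eq_ofNat_of_zero_le (show 0 ≤ l - 1 by omega)
  have hln : l = n + 1 := by omega
  have hjkl : j = k + l := by
    have : (j : ℝ) = k + l := by rw [← hjx, add_div, hk, hl]
    exact_mod_cast this
  refine ⟨n, k - 1, ?_, ?_, ?_⟩
  · rw [show k - 1 + (n : ℤ) = j - 2 by omega]
    exact hj.sub even_two
  · rw [div_eq_iff hε.ne'] at hk
    rw [hk]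
    push_cast
    ring
  · rw [div_eq_iff hε.ne'] at hl
    rw [hl, hln]
    push_cast
    ring

/-- Without mass every turn has weight zero, leaving only the straight path, which ends on the line
`x = t`. -/
theorem kernel_massless {x t ε : ℝ} (hε : 0 < ε) (ht : 0 < t) (hl : (x, t) ∈ lattice ε)
    (he : ∃ j : ℤ, Even j ∧ (x + t) / ε = j) (hxt : x ≠ t) : a x t 0 ε = 0 := by
  obtain ⟨n, K, hK, rfl, rfl⟩ := exists_steps hε ht hl he
  have hKn : K - n ≠ 0 := by
    intro h
    have h2 : K = n := by omega
    exact hxt (by rw [h2]; push_cast; ring)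
  have heven : Even (K - (n : ℤ)) := by
    rw [show K - (n : ℤ) = K + n - 2 * n by ring]
    exact hK.sub (even_two_mul _)
  have hint := integral_exp_even (K - n) heven
  rw [if_neg hKn] at hint
  have hw : -Complex.I * ((0 : ℝ) : ℂ) * (ε : ℂ) = 0 := by simp
  rw [a, hw, finsum_pathsTo hε 0 n K hK]
  have hexp : ∀ θ : ℝ, Complex.exp (-(K * (θ * Complex.I))) * (stepFourier 0 θ n).1 =
      Complex.exp (-(((K - n : ℤ) : ℂ) * (θ * Complex.I))) := fun θ => by
    rw [stepFourier_zero_fst, ← Complex.exp_add]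
    congr 1
    push_cast
    ring
  simp only [hexp, hint, mul_zero]

/-- The trigonometric closed form is split into `exp(±inω)`. A factor `exp(-iθ)` moved from the
amplitude into the phase turns `K` into `K + 1 = x/ε`. -/
theorem integrand_eq {μ : ℝ} (hμ : 0 < μ) (n : ℕ) (K : ℤ) (θ : ℝ) :
    ((1 / Real.sqrt (1 + μ ^ 2) : ℝ) : ℂ) ^ n *
      (Complex.exp (-(K * (θ * Complex.I))) * (stepFourier (-Complex.I * μ) θ n).1) =
    1 / 2 * (amplitude μ 1 θ *
        Complex.exp ((1 : ℝ) * Complex.I * (n * freq μ θ + -(K + 1) * θ : ℝ)) +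
      amplitude μ (-1) θ *
        Complex.exp ((-1 : ℝ) * Complex.I * (n * freq μ θ + (K + 1) * θ : ℝ))) := by
  have hs : (0 : ℝ) < Real.sqrt (1 + μ ^ 2) := Real.sqrt_pos.2 (by positivity)
  have hs2 : Real.sqrt (1 + μ ^ 2) ^ 2 = 1 + μ ^ 2 := Real.sq_sqrt (by positivity)
  have hE := energy_pos hμ θ
  have hEC : (energy μ θ : ℂ) ≠ 0 := by exact_mod_cast hE.ne'
  have hsC : (Real.sqrt (1 + μ ^ 2) : ℂ) ≠ 0 := by exact_mod_cast hs.ne'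
  have hs2C : (Real.sqrt (1 + μ ^ 2) : ℂ) ^ 2 = 1 + μ ^ 2 := by exact_mod_cast hs2
  have hsin : Complex.sin (freq μ θ) = energy μ θ / Real.sqrt (1 + μ ^ 2) := by
    exact_mod_cast sin_freq μ θ
  have hcl := (stepFourier_closed (-Complex.I * μ) θ ((1 / Real.sqrt (1 + μ ^ 2) : ℝ) : ℂ)
    (freq μ θ) (by
      have h1 : (1 + μ ^ 2 : ℂ) ≠ 0 := by rw [← hs2C]; exact pow_ne_zero 2 hsC
      push_cast
      rw [div_pow, hs2C, mul_pow, neg_sq, Complex.I_sq]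
      field_simp
      ring) (by
      have := cos_freq μ θ
      rw [← Complex.ofReal_cos, this]
      push_cast
      ring) (by
      rw [hsin]
      exact div_ne_zero hEC hsC) n).1
  rw [mul_left_comm, hcl, hsin]
  simp only [amplitude, sin_velocityAngle hμ, cos_velocityAngle hμ, velocity]
  have hez : Complex.exp (θ * Complex.I) = Complex.cos θ + Complex.sin θ * Complex.I :=
    Complex.exp_mul_I _
  have hez' : Complex.exp (-(θ * Complex.I)) * Complex.exp (θ * Complex.I) = 1 := by
    rw [← Complex.exp_add]; simp
  have e1 : Complex.exp ((1 : ℝ) * Complex.I * (n * freq μ θ + -(K + 1) * θ : ℝ)) =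
      Complex.exp (n * freq μ θ * Complex.I) * (Complex.exp (-(K * (θ * Complex.I))) *
        Complex.exp (-(θ * Complex.I))) := by
    rw [← Complex.exp_add, ← Complex.exp_add]
    congr 1
    push_cast
    ring
  have e2 : Complex.exp ((-1 : ℝ) * Complex.I * (n * freq μ θ + (K + 1) * θ : ℝ)) =
      Complex.exp (-(n * freq μ θ) * Complex.I) * (Complex.exp (-(K * (θ * Complex.I))) *
        Complex.exp (-(θ * Complex.I))) := by
    rw [← Complex.exp_add, ← Complex.exp_add]
    congr 1
    push_cast
    ring
  rw [e1, e2, Complex.exp_mul_I (n * freq μ θ), Complex.exp_mul_I (-(n * freq μ θ)),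
    Complex.cos_neg, Complex.sin_neg]
  push_cast
  generalize Complex.exp (-(K * (θ * Complex.I))) = B at *
  generalize Complex.exp (-(θ * Complex.I)) = z' at *
  generalize Complex.exp (θ * Complex.I) = z at *
  generalize Complex.cos (n * freq μ θ) = C at *
  generalize Complex.sin (n * freq μ θ) = S at *
  generalize Complex.sin θ = q at *
  generalize Complex.cos θ = r at *
  subst hez
  have hquot : ∀ v : ℂ, S / (energy μ θ / Real.sqrt (1 + μ ^ 2)) *
      (1 / Real.sqrt (1 + μ ^ 2) * v) = S / energy μ θ * v := fun v => by
    field_simp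
  rw [hquot]
  linear_combination -(B * (C + S * Complex.I * q / energy μ θ)) * hez'

theorem rpow_normalization {μ : ℝ} (n : ℕ) :
    (1 + μ ^ 2) ^ (-(n : ℝ) / 2) = (1 / Real.sqrt (1 + μ ^ 2)) ^ n := by
  have h : (0 : ℝ) < 1 + μ ^ 2 := by positivity
  rw [one_div, Real.sqrt_eq_rpow, ← Real.rpow_neg h.le, ← Real.rpow_mul_natCast h.le]
  congr 1
  ring

/-- The kernel as a sum of the contributions of positive and negative frequencies. -/
theorem kernel_eq_waveIntegral {m x t ε : ℝ} (hm : 0 < m) (hε : 0 < ε) (ht : 0 < t)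
    (hl : (x, t) ∈ lattice ε) (he : ∃ j : ℤ, Even j ∧ (x + t) / ε = j) :
    0 ≤ t / ε - 1 ∧ a x t m ε = Complex.I / (2 * Real.pi) *
      (waveIntegral (m * ε) 1 (t / ε - 1) (-x / ε) (-(Real.pi / 2)) (Real.pi / 2) +
        waveIntegral (m * ε) (-1) (t / ε - 1) (x / ε) (-(Real.pi / 2)) (Real.pi / 2)) := by
  obtain ⟨n, K, hK, rfl, rfl⟩ := exists_steps hε ht hl he
  have hμ : 0 < m * ε := mul_pos hm hε
  have h1 : ((n : ℝ) + 1) * ε / ε - 1 = n := by field_simp; ring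
  have h2 : ((K : ℝ) + 1) * ε / ε = K + 1 := by field_simp
  have h3 : -(((K : ℝ) + 1) * ε) / ε = -(K + 1) := by field_simp
  rw [h1, h2, h3]
  refine ⟨n.cast_nonneg, ?_⟩
  have hw : -Complex.I * (m : ℂ) * (ε : ℂ) = -Complex.I * ((m * ε : ℝ) : ℂ) := by
    push_cast
    ring
  have hexp : (1 - ((n : ℝ) + 1) * ε / ε) / 2 = -(n : ℝ) / 2 := by
    rw [← neg_sub, h1]
  rw [a, hw, finsum_pathsTo hε _ n K hK, hexp, ← mul_pow, rpow_normalization]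
  simp only [waveIntegral]
  rw [← intervalIntegral.integral_add (intervalIntegrable_wave hμ _ _ _ _ _)
    (intervalIntegrable_wave hμ _ _ _ _ _)]
  have hint : (((1 / Real.sqrt (1 + (m * ε) ^ 2)) ^ n : ℝ) : ℂ) *
      ∫ θ in (-(Real.pi / 2))..(Real.pi / 2), Complex.exp (-(K * (θ * Complex.I))) *
        (stepFourier (-Complex.I * ((m * ε : ℝ) : ℂ)) θ n).1 =
      1 / 2 * ∫ θ in (-(Real.pi / 2))..(Real.pi / 2), (amplitude (m * ε) 1 θ *
        Complex.exp ((1 : ℝ) * Complex.I * (n * freq (m * ε) θ + -(K + 1) * θ : ℝ)) +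
      amplitude (m * ε) (-1) θ *
        Complex.exp ((-1 : ℝ) * Complex.I * (n * freq (m * ε) θ + (K + 1) * θ : ℝ))) := by
    rw [← intervalIntegral.integral_const_mul, ← intervalIntegral.integral_const_mul]
    congr 1
    ext θ
    rw [← integrand_eq hμ, Complex.ofReal_pow]
  calc _ = Complex.I / Real.pi * ((((1 / Real.sqrt (1 + (m * ε) ^ 2)) ^ n : ℝ) : ℂ) *
      ∫ θ in (-(Real.pi / 2))..(Real.pi / 2), Complex.exp (-(K * (θ * Complex.I))) *
        (stepFourier (-Complex.I * ((m * ε : ℝ) : ℂ)) θ n).1) := by ring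
    _ = _ := by
      rw [hint]
      ring

/-! ### Passage to the limit -/

section Limit

variable {m : ℝ} {x t ε : ℕ → ℝ}

theorem eventually_ne_of_tendsto (ht : ∀ n, 0 < t n)
    (hlim_t : Tendsto (fun n => 1 / t n) atTop (𝓝 0))
    (hlim_x : Tendsto (fun n => x n / t n ^ (3 / 4 : ℝ)) atTop (𝓝 0)) :
    ∀ᶠ n in atTop, x n ≠ t n := by
  filter_upwards [hlim_t.eventually_lt_const zero_lt_one,
    hlim_x.eventually_lt_const zero_lt_one] with n h1 h2 h3
  have h4 : 1 < t n := by
    rw [div_lt_one (ht n)] at h1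
    exact h1
  rw [div_lt_one (Real.rpow_pos_of_pos (ht n) _), h3] at h2
  have h5 : t n ^ (3 / 4 : ℝ) ≤ t n ^ (1 : ℝ) :=
    Real.rpow_le_rpow_of_exponent_le h4.le (by norm_num)
  rw [Real.rpow_one] at h5
  linarith

theorem tendsto_kernel_div {τ : ℕ → ℝ} (hm : 0 < m) (hε : ∀ n, 0 < ε n) (hτ0 : ∀ n, 0 < τ n)
    (hτ : Tendsto τ atTop atTop) (hlattice : ∀ n, (x n, τ n ^ 4) ∈ lattice (ε n))
    (heven : ∀ n, ∃ j : ℤ, Even j ∧ (x n + τ n ^ 4) / ε n = j)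
    (hlim_x : Tendsto (fun n => x n / τ n ^ 3) atTop (𝓝 0))
    (hlim_ε : Tendsto (fun n => ε n * τ n ^ 2) atTop (𝓝 0)) :
    Tendsto (fun n => 1 / (2 * Complex.I * (ε n : ℂ)) * a (x n) (τ n ^ 4) m (ε n) /
      (((Real.sqrt (m / (2 * Real.pi * τ n ^ 4)) : ℝ) : ℂ) *
        Complex.exp (-Complex.I * (m : ℂ) * ((τ n ^ 4 : ℝ) : ℂ) - Complex.I * (Real.pi : ℂ) / 4
          + Complex.I * (m : ℂ) * (x n : ℂ) ^ 2 / (2 * ((τ n ^ 4 : ℝ) : ℂ))))) atTop (𝓝 1) := by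
  have hker := fun n => kernel_eq_waveIntegral hm (hε n) (pow_pos (hτ0 n) 4) (hlattice n) (heven n)
  have hN : ∀ n, (τ n ^ 4 / ε n - 1) * ε n + ε n = τ n ^ 4 := fun n => by
    have := (hε n).ne'
    field_simp
    ring
  have hlim_x' : Tendsto (fun n => -x n / τ n ^ 3) atTop (𝓝 0) := by
    have := hlim_x.neg
    rw [neg_zero] at this
    refine this.congr fun n => ?_
    ring
  have h1 := tendsto_waveIntegral hm (s := 1) (by simp) hε hτ0 hτ hlim_x' hlim_ε
    (fun n => (hker n).1) hN
  have h2 := tendsto_waveIntegral hm (s := -1) (by simp) hε hτ0 hτ hlim_x hlim_ε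
    (fun n => (hker n).1) hN
  rw [neg_neg, fresnel_value hm] at h2
  -- For `s = 1` the factor `1 - s` kills the limit. The unimodular factor `exp(2iP)`, with `P` the
  -- stationary phase, brings this wave to the normalization of the other one without affecting
  -- convergence to zero.
  have hphase : Tendsto (fun n => Complex.exp ((2 : ℝ) * Complex.I *
      (m * τ n ^ 4 - m * x n ^ 2 / (2 * τ n ^ 4) : ℝ)) * ((τ n ^ 2 / ε n : ℝ) *
      Complex.exp (-((1 : ℝ) * Complex.I *
        (m * τ n ^ 4 - m * (-x n) ^ 2 / (2 * τ n ^ 4) : ℝ))) *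
      waveIntegral (m * ε n) 1 (τ n ^ 4 / ε n - 1) (-x n / ε n) (-(Real.pi / 2))
        (Real.pi / 2))) atTop (𝓝 0) := by
    rw [Complex.ofReal_one, sub_self, zero_mul] at h1
    rw [Complex.ofReal_one]
    refine squeeze_zero_norm (fun n => ?_) (tendsto_zero_iff_norm_tendsto_zero.1 h1)
    rw [norm_mul, norm_exp_mul_I_mul, one_mul]
  have hsq : (Real.sqrt (2 * Real.pi * m) : ℂ) ≠ 0 := by
    exact_mod_cast (Real.sqrt_pos.2 (by positivity : (0 : ℝ) < 2 * Real.pi * m)).ne'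
  have hsum := (hphase.add h2).const_mul (Complex.exp (Complex.I * Real.pi / 4) /
    (2 * Real.sqrt (2 * Real.pi * m)))
  have hlimit : Complex.exp (Complex.I * Real.pi / 4) / (2 * Real.sqrt (2 * Real.pi * m)) *
      (0 + (1 - ((-1 : ℝ) : ℂ)) * ((Real.sqrt (2 * Real.pi * m) : ℂ) *
        Complex.exp (-(Complex.I * Real.pi / 4)))) = 1 := by
    rw [Complex.exp_neg]
    have := Complex.exp_ne_zero (Complex.I * Real.pi / 4)
    push_cast
    field_simp
    ring
  rw [hlimit] at hsum
  refine hsum.congr fun n => ?_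
  rw [(hker n).2]
  have hroot : Real.sqrt (m / (2 * Real.pi * τ n ^ 4)) =
      Real.sqrt (2 * Real.pi * m) / (2 * Real.pi * τ n ^ 2) := by
    have := hτ0 n
    rw [show m / (2 * Real.pi * τ n ^ 4) = 2 * Real.pi * m / (2 * Real.pi * τ n ^ 2) ^ 2 by
      field_simp, Real.sqrt_div (by positivity), Real.sqrt_sq (by positivity)]
  rw [hroot, neg_sq]
  set P : ℝ := m * τ n ^ 4 - m * x n ^ 2 / (2 * τ n ^ 4) with hP
  have hE : -Complex.I * (m : ℂ) * ((τ n ^ 4 : ℝ) : ℂ) - Complex.I * (Real.pi : ℂ) / 4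
      + Complex.I * (m : ℂ) * (x n : ℂ) ^ 2 / (2 * ((τ n ^ 4 : ℝ) : ℂ)) =
      -(Complex.I * P) + -(Complex.I * Real.pi / 4) := by
    rw [hP]
    push_cast
    ring
  have hE1 : Complex.exp ((2 : ℝ) * Complex.I * P) =
      Complex.exp (Complex.I * P) * Complex.exp (Complex.I * P) := by
    rw [← Complex.exp_add]
    congr 1
    push_cast
    ring
  have hE2 : -((1 : ℝ) * Complex.I * P) = -(Complex.I * P) := by simp
  have hE3 : -(((-1 : ℝ) : ℂ) * Complex.I * P) = Complex.I * P := by simp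
  rw [hE, hE1, hE2, hE3, Complex.exp_add, Complex.exp_neg, Complex.exp_neg]
  have n1 := Complex.exp_ne_zero (Complex.I * P)
  have n2 := Complex.exp_ne_zero (Complex.I * Real.pi / 4)
  have n3 : (ε n : ℂ) ≠ 0 := by exact_mod_cast (hε n).ne'
  have n4 : (τ n : ℂ) ≠ 0 := by exact_mod_cast (hτ0 n).ne'
  have n5 : (Real.pi : ℂ) ≠ 0 := by exact_mod_cast Real.pi_ne_zero
  have n6 := Complex.I_ne_zero
  push_cast
  field_simp

theorem eventually_kernel_massless (hε : ∀ n, 0 < ε n) (ht : ∀ n, 0 < t n)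
    (hlattice : ∀ n, (x n, t n) ∈ lattice (ε n))
    (heven : ∀ n, ∃ j : ℤ, Even j ∧ (x n + t n) / ε n = j)
    (hlim_t : Tendsto (fun n => 1 / t n) atTop (𝓝 0))
    (hlim_x : Tendsto (fun n => x n / t n ^ (3 / 4 : ℝ)) atTop (𝓝 0)) :
    ∀ᶠ n in atTop, a (x n) (t n) 0 (ε n) = 0 :=
  (eventually_ne_of_tendsto ht hlim_t hlim_x).mono fun n hn =>
    kernel_massless (hε n) (ht n) (hlattice n) (heven n) hn

end Limit

end FeynmanCheckers

theorem mainTheorem2 (m : ℝ) (hm : 0 ≤ m) (x t ε : ℕ → ℝ)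
    (hε : ∀ n, 0 < ε n) (ht : ∀ n, 0 < t n)
    (hlattice : ∀ n, (x n, t n) ∈ FeynmanCheckers.lattice (ε n))
    (heven : ∀ n, ∃ j : ℤ, Even j ∧ (x n + t n) / ε n = j)
    (hlim_t : Tendsto (fun n => 1 / t n) atTop (𝓝 0))
    (hlim_x : Tendsto (fun n => x n / t n ^ (3 / 4 : ℝ)) atTop (𝓝 0))
    (hlim_ε : Tendsto (fun n => ε n * t n ^ (1 / 2 : ℝ)) atTop (𝓝 0)) :
    (fun n => 1 / (2 * Complex.I * (ε n : ℂ)) * FeynmanCheckers.a (x n) (t n) m (ε n))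
      ~[atTop]
    (fun n => ((Real.sqrt (m / (2 * Real.pi * t n)) : ℝ) : ℂ) *
      Complex.exp (-Complex.I * (m : ℂ) * (t n : ℂ) - Complex.I * (Real.pi : ℂ) / 4
        + Complex.I * (m : ℂ) * (x n : ℂ) ^ 2 / (2 * (t n : ℂ)))) := by
  rcases hm.eq_or_lt with rfl | hm
  -- For `m = 0` the right-hand side vanishes, so equivalence requires the kernel to be eventually
  -- zero; it is, since eventually `x ≠ t`.
  · refine EventuallyEq.isEquivalent ?_
    filter_upwards [FeynmanCheckers.eventually_kernel_massless hε ht hlattice heven hlim_t hlim_x]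
      with n hn
    simp [hn]
  · have hτ : ∀ n, ∀ j : ℕ, (t n ^ (1 / 4 : ℝ)) ^ j = t n ^ ((j : ℝ) / 4) := fun n j => by
      rw [← Real.rpow_natCast, ← Real.rpow_mul (ht n).le]
      congr 1
      ring
    -- Passing to `τ = t^(1/4)` makes every exponent in the hypotheses a natural number.
    obtain ⟨τ, hτ0, hτ2, hτ3, hτ4⟩ : ∃ τ : ℕ → ℝ, (∀ n, 0 < τ n) ∧
        (∀ n, t n ^ (1 / 2 : ℝ) = τ n ^ 2) ∧ (∀ n, t n ^ (3 / 4 : ℝ) = τ n ^ 3) ∧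
        ∀ n, t n = τ n ^ 4 := by
      refine ⟨fun n => t n ^ (1 / 4 : ℝ), fun n => Real.rpow_pos_of_pos (ht n) _, fun n => ?_,
        fun n => ?_, fun n => ?_⟩
      · rw [hτ]
        norm_num
      · rw [hτ]
        norm_num
      · rw [hτ]
        norm_num
    have htop : Tendsto t atTop atTop := by
      have h : Tendsto (fun n => 1 / t n) atTop (𝓝[>] 0) :=
        tendsto_nhdsWithin_iff.2 ⟨hlim_t, Eventually.of_forall fun n => one_div_pos.2 (ht n)⟩
      refine h.inv_tendsto_nhdsGT_zero.congr fun n => ?_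
      simp
    simp only [hτ2, hτ3] at hlim_x hlim_ε
    obtain rfl : t = fun n => τ n ^ 4 := funext hτ4
    have hτtop : Tendsto τ atTop atTop := by
      refine tendsto_atTop.2 fun b => ?_
      filter_upwards [htop.eventually_ge_atTop (b ^ 4)] with n hn
      by_contra! h
      exact (pow_lt_pow_left₀ h (hτ0 n).le four_ne_zero).not_ge hn
    refine isEquivalent_of_tendsto_one ?_
    exact FeynmanCheckers.tendsto_kernel_div hm hε hτ0 hτtop hlattice heven hlim_x hlim_ε
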